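/- Let $E$ be a complex Banach space and $r\in[1,\infty)$. Fix a Schwartz function $\varphi$ on $\mathbb R$ with $0\le\widehat\varphi\le 1$, $\widehat\varphi(\xi)=1$ for $|\xi|\le 1$ and $\widehat\varphi(\xi)=0$ for $|\xi|\ge \frac32$; put $\widehat\varphi_0=\widehat\varphi$, $\widehat\varphi_1=\widehat\varphi(\cdot/2)-\widehat\varphi$ and $\widehat\varphi_k=\widehat\varphi_1(2^{-k+1}\cdot)$ for $k\ge2$. For $p,q\in[1,\infty]$ and $s\in\mathbb R$ let $B^s_{p,q}(\mathbb R;E)$ be the space of all $u\in\mathcal S'(\mathbb R;E)$ with $$\|u\|_{B^s_{p,q}}=\big\|\big(2^{ks}\|\varphi_k*u\|_{L^p(\mathbb R;E)}\big)_{k\ge0}\big\|_{\ell^q}<\infty .$$ For $f\colon\mathbb R\to E$ let $$\|f\|_{V^r}=\|f\|_{L^\infty}+\sup_{t_0<\dots<t_N}\Big(\sum_{i=0}^{N-1}\|f(t_{i+1})-f(t_i)\|^r\Big)^{1/r}.$$ An $R^r$-atom is a function $a=\sum_{I\in\mathcal I}c_I\mathbf 1_I$ with $\mathcal I$ a set of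 mutually disjoint intervals, $c_I\in E$ and $\big(\sum_{I\in\mathcal I}\|c_I\|^r\big)^{1/r}\le1$; and $\|f\|_{R^r}$ is the infimum of $\sum_{k\ge1}|\lambda_k|$ over all representations $f=\sum_{k\ge1}\lambda_ka_k$ with $(\lambda_k)_{k\geq 1}\in\ell^1$ complex and $R^r$-atoms $a_k$ ($\infty$ if there is none). In the intersections $V^r\cap L^r$ and $R^r\cap L^r$ (with the sum of the two norms) functions that agree almost everywhere are identified, the norm being the infimum over the representatives, and functions in $L^r(\mathbb R;E)$ are viewed as tempered distributions. With $X\hookrightarrow Y$ meaning that $X\subseteq Y$ with $\|u\|_Y\le C\|u\|_X$ for all $u\in X$ and a constant $C$ independent of $u$, one has for $r>1$ $$B^{1/r}_{r,1}(\mathbb R;E)\hookrightarrow R^r(\mathbb R;E)\cap L^r(\mathbb R;E)\hookrightarrow V^r(\mathbb R;E)\cap L^r(\mathbb R;E)\hookrightarrow B^{1/r}_{r,\infty}(\mathbb R;E),$$ where the middle embedding also holds, with its norm estimate, for functions defined everywhere (without identification), and for $r=1$ $$B^1_{1,1}(\mathbb R;E)\hookrightarrow V^1(\mathbb R;E)\cap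 L^1(\mathbb R;E)\hookrightarrow B^1_{1,\infty}(\mathbb R;E).$$ -/

import Mathlib

open MeasureTheory
open scoped SchwartzMap FourierTransform ENNReal NNReal

noncomputable section

namespace BesovVariation

variable {E : Type*} [NormedAddCommGroup E] [NormedSpace ℂ E]

/-- The function `f` lies in `L^p(ℝ; E)` and the tempered distribution `u` is the one given by
integration against `f`. Up to a.e. equality, `f` is determined by `u`. -/
def Represents (p : ℝ≥0∞) (f : ℝ → E) (u : 𝓢'(ℝ, E)) : Prop :=
  MemLp f p volume ∧ ∀ g : 𝓢(ℝ, ℂ), u g = ∫ x : ℝ, g x • f x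

/-! ### Besov spaces -/

/-- The condition on the function generating the Littlewood-Paley decomposition: its Fourier
transform is `[0, 1]`-valued, equals `1` for `|ξ| ≤ 1` and vanishes for `|ξ| ≥ 3 / 2`. -/
structure IsGenerator (φ : 𝓢(ℝ, ℂ)) : Prop where
  mem_Icc : ∀ ξ : ℝ, ∃ t : ℝ, 0 ≤ t ∧ t ≤ 1 ∧ (𝓕 φ) ξ = (t : ℂ)
  eq_one : ∀ ξ : ℝ, |ξ| ≤ 1 → (𝓕 φ) ξ = 1
  eq_zero : ∀ ξ : ℝ, 3 / 2 ≤ |ξ| → (𝓕 φ) ξ = 0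

/-- The Fourier transforms of the functions `φ_k` of the Littlewood-Paley decomposition
generated by `φ`: the transform of `φ_0` is that of `φ`, the transform of `φ_1` is
`ξ ↦ 𝓕 φ (ξ / 2) - 𝓕 φ ξ`, and that of `φ_{k+1}` is the one of `φ_1` at `2^{-k} ξ`. -/
def symbol (φ : 𝓢(ℝ, ℂ)) : ℕ → ℝ → ℂ
  | 0 => fun ξ => (𝓕 φ) ξ
  | k + 1 => fun ξ => (𝓕 φ) ((2 ^ k)⁻¹ * ξ / 2) - (𝓕 φ) ((2 ^ k)⁻¹ * ξ)

/-- The Littlewood-Paley piece `φ_k * u` of a tempered distribution `u`, that is, the inverse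
Fourier transform of the product of the `k`-th symbol and the Fourier transform of `u`. -/
def piece (φ : 𝓢(ℝ, ℂ)) (k : ℕ) (u : 𝓢'(ℝ, E)) : 𝓢'(ℝ, E) :=
  TemperedDistribution.fourierMultiplierCLM E (symbol φ k) u

/-- The `L^p` norm of a tempered distribution; it is `∞` if the distribution is not given by an
`L^p` function. -/
def lpENorm (p : ℝ≥0∞) (u : 𝓢'(ℝ, E)) : ℝ≥0∞ :=
  ⨅ (f : ℝ → E) (_ : Represents p f u), eLpNorm f p volume

/-- The norm of `ℓ^q` for sequences with values in `[0, ∞]`. -/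
def seqENorm (q : ℝ≥0∞) (a : ℕ → ℝ≥0∞) : ℝ≥0∞ :=
  if q = ∞ then ⨆ k, a k else (∑' k, a k ^ q.toReal) ^ (1 / q.toReal)

/-- The norm of `B^s_{p,q}(ℝ; E)` on tempered distributions, with values in `[0, ∞]`; the Besov
space consists of the distributions for which it is finite. -/
def besovENorm (φ : 𝓢(ℝ, ℂ)) (s : ℝ) (p q : ℝ≥0∞) (u : 𝓢'(ℝ, E)) : ℝ≥0∞ :=
  seqENorm q fun k => ENNReal.ofReal ((2 : ℝ) ^ ((k : ℝ) * s)) * lpENorm p (piece φ k u)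

/-! ### The spaces `V^r` and `R^r` -/

/-- The `r`-variation seminorm of a function on `ℝ`, over all finite sequences
`t_0 < ⋯ < t_N`. -/
def variationSeminorm (r : ℝ) (f : ℝ → E) : ℝ≥0∞ :=
  ⨆ (N : ℕ) (t : Fin (N + 1) → ℝ) (_ : StrictMono t),
    (∑ i : Fin N, ‖f (t i.succ) - f (t i.castSucc)‖ₑ ^ r) ^ (1 / r)

/-- The norm of `V^r(ℝ; E)`, with values in `[0, ∞]`. -/
def vENorm (r : ℝ) (f : ℝ → E) : ℝ≥0∞ :=
  eLpNorm f ∞ volume + variationSeminorm r f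

/-- `R^r(ℝ; E)`-atoms: sums `∑_I c_I 1_I` over a family of mutually disjoint intervals with
`(∑_I ‖c_I‖ ^ r) ^ (1 / r) ≤ 1`. At every point at most one term of the sum is nonzero. -/
def IsAtom (r : ℝ) (a : ℝ → E) : Prop :=
  ∃ (𝓘 : Set (Set ℝ)) (c : Set ℝ → E),
    (∀ I ∈ 𝓘, I.OrdConnected) ∧ 𝓘.PairwiseDisjoint id ∧
    (∀ x, a x = ∑' I : 𝓘, (I : Set ℝ).indicator (fun _ => c I) x) ∧
    (∑' I : 𝓘, ‖c I‖ₑ ^ r) ^ (1 / r) ≤ 1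

/-- The norm of `R^r(ℝ; E)`, with values in `[0, ∞]`: the infimum of `∑_k |λ_k|` over all
representations `f = ∑_k λ_k a_k` with `(λ_k)` in `ℓ^1` and atoms `a_k`. Such series converge
absolutely and uniformly, so that such an `f` is automatically in `L^∞`. -/
def rENorm (r : ℝ) (f : ℝ → E) : ℝ≥0∞ :=
  ⨅ (l : ℕ → ℂ) (a : ℕ → ℝ → E)
    (_ : Summable (fun k => ‖l k‖) ∧ (∀ k, IsAtom r (a k)) ∧
      ∀ x, HasSum (fun k => l k • a k x) (f x)),
    ∑' k, ‖l k‖ₑ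

/-! ### Intersections with `L^p` and embeddings -/

/-- Given the norm `N` of a space `Z` of functions, the norm of `Z ∩ L^p(ℝ; E)`, seen as a space
of tempered distributions; functions that agree almost everywhere are identified, so that the
infimum runs over the representatives of one element of `L^p`. -/
def interLpENorm (p : ℝ≥0∞) (N : (ℝ → E) → ℝ≥0∞) (u : 𝓢'(ℝ, E)) : ℝ≥0∞ :=
  ⨅ (f : ℝ → E) (_ : Represents p f u), N f + eLpNorm f p volume

/-- The continuous embedding `X ↪ Y` of spaces of tempered distributions, each given as the set
where its `[0, ∞]`-valued norm is finite: `X ⊆ Y`, and the inclusion is bounded. -/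
def Embeds (NX NY : 𝓢'(ℝ, E) → ℝ≥0∞) : Prop :=
  ∃ C : ℝ≥0, ∀ u, NX u < ∞ → NY u ≤ C * NX u

end BesovVariation

end

noncomputable section

namespace BesovVariation

variable {E : Type*} [NormedAddCommGroup E] [NormedSpace ℂ E]

open Filter Topology

set_option linter.unusedSectionVars false

/-! ### Inequalities for lower Lebesgue integrals -/

/-! The embedding of `B^{1/r}_{r,1}` is proved piece by piece. Each piece `φ_k * u` equals its own
convolution with the wider kernel at level `k + 1`, so it is a smooth function `F` whose increments
are dominated by the integral of some `G` with `‖G‖_r ≲ 2^k ‖φ_k * u‖_r`. For `r > 1`, sample `F` on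
the dyadic grids of width `h / 2^m`, where `h = 2^{-k}`, and telescope. By Hölder, the values of the
`m`-th difference of step functions have `ℓ^r` norm at most a constant times `2^{-m(1 - 1/r)}
2^{k/r} ‖φ_k * u‖_r`. Step functions on a grid are multiples of atoms, so summing over `m` (a
geometric series exactly because `r > 1`) and then over `k` gives an atomic series controlled by the
Besov norm (`hasGridExpansion_of_enorm_sub_le`, `embeds_besovENorm_of_piece`). For `r = 1` the
variation of each piece is bounded directly by the `L^1` norm of its derivative.

For `R^r` into `V^r`, an increasing sequence of points enters each interval of an atom at most once
and leaves it at most once. An atom therefore has `V^r` norm at most `1 + 2`, and the `V^r` norm is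
countably subadditive.

For `V^r` into `B^{1/r}_{r,∞}`, cutting the line into lattices of step `|y|` gives `‖f(· - y) -
f‖_r^r ≤ |y| Var_r(f)^r`. A kernel of mass one at scale `2^{-n}` then approximates `f` in `L^r` with
error of order `2^{-n/r}`, and a Littlewood-Paley piece is the difference of two such errors. -/

/-- Jensen's inequality for the weight `k`, obtained from Hölder applied to `k g = k^{1 - 1/r} (k
g^r)^{1/r}`; this form includes `r = 1`. -/
theorem lintegral_mul_rpow_le {α : Type*} [MeasurableSpace α] {μ : Measure α} {k g : α → ℝ≥0∞}
    (hk : AEMeasurable k μ) (hg : AEMeasurable g μ) {r : ℝ} (hr : 1 ≤ r) :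
    (∫⁻ x, k x * g x ∂μ) ^ r ≤ (∫⁻ x, k x ∂μ) ^ (r - 1) * ∫⁻ x, k x * g x ^ r ∂μ := by
  have hr0 : 0 < r := by linarith
  have h1 : 0 ≤ 1 - 1 / r := by
    rw [sub_nonneg, div_le_one hr0]; exact hr
  have h2 : 0 ≤ 1 / r := by positivity
  have key := ENNReal.lintegral_mul_norm_pow_le hk (hk.mul (hg.pow_const r)) h1 h2 (by ring)
  have e : ∀ x, k x ^ (1 - 1 / r) * (k * fun x => g x ^ r) x ^ (1 / r) = k x * g x := by
    intro x
    rw [Pi.mul_apply, ENNReal.mul_rpow_of_nonneg _ _ h2, ← mul_assoc,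
      ← ENNReal.rpow_add_of_nonneg _ _ h1 h2, ← ENNReal.rpow_mul]
    simp [hr0.ne']
  simp only [e] at key
  calc (∫⁻ x, k x * g x ∂μ) ^ r
      ≤ ((∫⁻ x, k x ∂μ) ^ (1 - 1 / r) * (∫⁻ x, k x * g x ^ r ∂μ) ^ (1 / r)) ^ r :=
        ENNReal.rpow_le_rpow key hr0.le
    _ = _ := by
        rw [ENNReal.mul_rpow_of_nonneg _ _ hr0.le, ← ENNReal.rpow_mul, ← ENNReal.rpow_mul]
        congr 2
        · field_simp
        · field_simp
          simp

theorem lintegral_rpow_le_measure {α : Type*} [MeasurableSpace α] {μ : Measure α} {g : α → ℝ≥0∞}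
    (hg : AEMeasurable g μ) {r : ℝ} (hr : 1 ≤ r) :
    (∫⁻ x, g x ∂μ) ^ r ≤ μ Set.univ ^ (r - 1) * ∫⁻ x, g x ^ r ∂μ := by
  simpa using lintegral_mul_rpow_le (μ := μ) (k := fun _ => 1) aemeasurable_const hg hr

theorem measurable_comp_sub {k : ℝ → ℝ≥0∞} (hk : Measurable k) :
    Measurable fun p : ℝ × ℝ => k (p.1 - p.2) :=
  hk.comp measurable_sub

/-- Replacing `g` by a measurable version leaves the convolution unchanged at every point. Genuine
measurability is what the grid estimates ask of their dominating functions. -/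
theorem measurable_lintegral_convolution {k g : ℝ → ℝ≥0∞} (hk : Measurable k)
    (hg : AEMeasurable g) : Measurable fun x => ∫⁻ y, k (x - y) * g y := by
  have : (fun x => ∫⁻ y, k (x - y) * g y) = fun x => ∫⁻ y, k (x - y) * hg.mk g y := by
    ext x
    refine lintegral_congr_ae ?_
    filter_upwards [hg.ae_eq_mk] with y hy
    rw [hy]
  rw [this]
  exact Measurable.lintegral_prod_right
    ((measurable_comp_sub hk).mul (hg.measurable_mk.comp measurable_snd))

/-- Young's inequality for convolution with an integrable kernel. -/
theorem lintegral_convolution_rpow_le {k g : ℝ → ℝ≥0∞} (hk : Measurable k)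
    (hg : AEMeasurable g) {r : ℝ} (hr : 1 ≤ r) :
    ∫⁻ x, (∫⁻ y, k (x - y) * g y) ^ r ≤ (∫⁻ x, k x) ^ r * ∫⁻ x, g x ^ r := by
  have hm : AEMeasurable (Function.uncurry fun x y : ℝ => k (x - y) * g y ^ r)
      (volume.prod volume) :=
    (measurable_comp_sub hk).aemeasurable.mul ((hg.pow_const r).comp_snd)
  calc ∫⁻ x, (∫⁻ y, k (x - y) * g y) ^ r
      ≤ ∫⁻ x, (∫⁻ y, k y) ^ (r - 1) * ∫⁻ y, k (x - y) * g y ^ r := by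
        refine lintegral_mono fun x => ?_
        have := lintegral_mul_rpow_le (μ := volume) (k := fun y => k (x - y)) (g := g)
          (hk.comp (measurable_const.sub measurable_id)).aemeasurable hg hr
        rwa [lintegral_sub_left_eq_self k x] at this
    _ = (∫⁻ y, k y) ^ (r - 1) * ∫⁻ y, (∫⁻ x, k (x - y)) * g y ^ r := by
        rw [lintegral_const_mul'' _ (f := fun x => ∫⁻ y, k (x - y) * g y ^ r) hm.lintegral_prod_right',
          lintegral_lintegral_swap hm]
        congr 1
        refine lintegral_congr fun y => ?_
        exact lintegral_mul_const _ (f := fun x => k (x - y)) (hk.comp (measurable_id.sub measurable_const))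
    _ = _ := by
        simp_rw [lintegral_sub_right_eq_self k]
        rw [lintegral_const_mul'' _ (hg.pow_const r), ← mul_assoc]
        congr 1
        nth_rw 2 [← ENNReal.rpow_one (∫⁻ y, k y)]
        rw [← ENNReal.rpow_add_of_nonneg _ _ (by linarith) zero_le_one]
        simp

/-- Minkowski's inequality for countable sums. -/
theorem Lp_tsum_le {ι : Type*} (s : Finset ι) (b : ℕ → ι → ℝ≥0∞) {r : ℝ} (hr : 1 ≤ r) :
    (∑ i ∈ s, (∑' k, b k i) ^ r) ^ (1 / r) ≤ ∑' k, (∑ i ∈ s, b k i ^ r) ^ (1 / r) := by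
  have hr0 : 0 < r := by linarith
  have fin : ∀ n : ℕ, (∑ i ∈ s, (∑ k ∈ Finset.range n, b k i) ^ r) ^ (1 / r) ≤
      ∑ k ∈ Finset.range n, (∑ i ∈ s, b k i ^ r) ^ (1 / r) := by
    intro n
    induction n with
    | zero => simp [hr0]
    | succ n ih =>
      simp only [Finset.sum_range_succ]
      exact (ENNReal.Lp_add_le _ _ _ hr).trans (by gcongr)
  have lim : Tendsto (fun n : ℕ => (∑ i ∈ s, (∑ k ∈ Finset.range n, b k i) ^ r) ^ (1 / r)) atTop
      (𝓝 ((∑ i ∈ s, (∑' k, b k i) ^ r) ^ (1 / r))) := by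
    refine (ENNReal.continuous_rpow_const.tendsto _).comp (tendsto_finsetSum _ fun i _ => ?_)
    exact (ENNReal.continuous_rpow_const.tendsto _).comp (ENNReal.tendsto_nat_tsum _)
  exact le_of_tendsto' lim fun n => (fin n).trans (ENNReal.sum_le_tsum _)

theorem enorm_le_tsum_of_hasSum {ι F : Type*} [NormedAddCommGroup F] {f : ι → F} {a : F}
    (h : HasSum f a) : ‖a‖ₑ ≤ ∑' k, ‖f k‖ₑ :=
  le_of_tendsto (h.enorm) (Eventually.of_forall fun _ =>
    (enorm_sum_le _ _).trans (ENNReal.sum_le_tsum _))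

theorem summable_of_tsum_enorm_ne_top {ι F : Type*} [NormedAddCommGroup F] [CompleteSpace F]
    {f : ι → F} (h : ∑' k, ‖f k‖ₑ ≠ ∞) : Summable f := by
  refine Summable.of_norm ?_
  have := ENNReal.summable_toReal h
  simpa using this

/-! ### Countable sums in `V^r`, and step functions -/

theorem variationSeminorm_le_of_hasSum {f : ℝ → E} {F : ℕ → ℝ → E} {r : ℝ} (hr : 1 ≤ r)
    (h : ∀ x, HasSum (fun k => F k x) (f x)) :
    variationSeminorm r f ≤ ∑' k, variationSeminorm r (F k) := by
  have hr0 : 0 < r := by linarith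
  refine iSup_le fun N => iSup₂_le fun t ht => ?_
  have minkowski := Lp_tsum_le (Finset.univ : Finset (Fin N))
    (fun k i => ‖F k (t i.succ) - F k (t i.castSucc)‖ₑ) hr
  have pointwise : ∀ i : Fin N, ‖f (t i.succ) - f (t i.castSucc)‖ₑ ≤
      ∑' k, ‖F k (t i.succ) - F k (t i.castSucc)‖ₑ := fun i =>
    enorm_le_tsum_of_hasSum ((h (t i.succ)).sub (h (t i.castSucc)))
  have bound : ∀ k, (∑ i : Fin N, ‖F k (t i.succ) - F k (t i.castSucc)‖ₑ ^ r) ^ (1 / r) ≤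
      variationSeminorm r (F k) := fun k => le_iSup_of_le N (le_iSup₂_of_le t ht le_rfl)
  refine le_trans ?_ (minkowski.trans (ENNReal.tsum_le_tsum bound))
  exact ENNReal.rpow_le_rpow (Finset.sum_le_sum fun i _ =>
    ENNReal.rpow_le_rpow (pointwise i) hr0.le) (by positivity)

theorem eLpNorm_top_le_of_hasSum {f : ℝ → E} {F : ℕ → ℝ → E}
    (h : ∀ x, HasSum (fun k => F k x) (f x)) :
    eLpNorm f ∞ volume ≤ ∑' k, eLpNorm (F k) ∞ volume := by
  simp only [eLpNorm_exponent_top]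
  refine essSup_le_of_ae_le _ ?_
  have := ae_all_iff.2 fun k => ae_le_eLpNormEssSup (f := F k) (μ := volume)
  filter_upwards [this] with x hx
  exact (enorm_le_tsum_of_hasSum (h x)).trans (ENNReal.tsum_le_tsum hx)

theorem vENorm_le_of_hasSum {f : ℝ → E} {F : ℕ → ℝ → E} {r : ℝ} (hr : 1 ≤ r)
    (h : ∀ x, HasSum (fun k => F k x) (f x)) :
    vENorm r f ≤ ∑' k, vENorm r (F k) := by
  simp only [vENorm]
  rw [ENNReal.tsum_add]
  exact add_le_add (eLpNorm_top_le_of_hasSum h) (variationSeminorm_le_of_hasSum hr h)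

theorem variationSeminorm_smul_le {r : ℝ} (hr : 0 < r) (l : ℂ) (a : ℝ → E) :
    variationSeminorm r (fun x => l • a x) ≤ ‖l‖ₑ * variationSeminorm r a := by
  refine iSup_le fun N => iSup₂_le fun t ht => ?_
  have : (∑ i : Fin N, ‖l • a (t i.succ) - l • a (t i.castSucc)‖ₑ ^ r) ^ (1 / r) =
      ‖l‖ₑ * (∑ i : Fin N, ‖a (t i.succ) - a (t i.castSucc)‖ₑ ^ r) ^ (1 / r) := by
    simp only [← smul_sub, enorm_smul, ENNReal.mul_rpow_of_nonneg _ _ hr.le]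
    rw [← Finset.mul_sum, ENNReal.mul_rpow_of_nonneg _ _ (by positivity), ← ENNReal.rpow_mul]
    simp [hr.ne']
  rw [this]
  gcongr
  exact le_iSup_of_le N (le_iSup₂_of_le t ht le_rfl)

theorem vENorm_smul_le {r : ℝ} (hr : 0 < r) (l : ℂ) (a : ℝ → E) :
    vENorm r (fun x => l • a x) ≤ ‖l‖ₑ * vENorm r a := by
  rw [vENorm, vENorm, mul_add]
  exact add_le_add (eLpNorm_const_smul l a ∞ volume).le (variationSeminorm_smul_le hr l a)

/-- Counting device for atoms: `P i` will say that a fixed interval is entered, or left, on the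
`i`-th step of a partition. -/
theorem sum_ite_le_of_subsingleton {ι : Type*} (s : Finset ι) (P : ι → Prop) [DecidablePred P]
    (hP : ∀ i j, P i → P j → i = j) (C : ℝ≥0∞) : ∑ i ∈ s, (if P i then C else 0) ≤ C := by
  classical
  by_cases h : ∃ i, P i
  · obtain ⟨i, hi⟩ := h
    calc ∑ j ∈ s, (if P j then C else 0) ≤ ∑ j ∈ insert i s, (if P j then C else 0) := by
          exact Finset.sum_le_sum_of_subset (Finset.subset_insert _ _)
      _ = C := by
          rw [Finset.sum_eq_single i]
          · simp [hi]
          · exact fun j _ hj => if_neg fun h => hj (hP _ _ h hi)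
          · simp
  · simp only [not_exists] at h
    simp [h]

open Classical in
/-- An atom changes its value at most twice on account of each interval. -/
theorem vENorm_le_of_isAtom {r : ℝ} (hr : 1 ≤ r) {a : ℝ → E} (ha : IsAtom r a) :
    vENorm r a ≤ 3 := by
  have hr0 : 0 < r := by linarith
  obtain ⟨𝓘, c, hconn, hdisj, hsum, hnorm⟩ := ha
  have hS : ∑' I : 𝓘, ‖c I‖ₑ ^ r ≤ 1 := by
    have := ENNReal.rpow_le_rpow hnorm hr0.le
    rwa [← ENNReal.rpow_mul, one_div_mul_cancel hr0.ne', ENNReal.rpow_one,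
      ENNReal.one_rpow] at this
  have hin : ∀ (x : ℝ) (I : 𝓘), x ∈ (I : Set ℝ) → a x = c I := by
    intro x I hx
    rw [hsum x, tsum_eq_single I]
    · simp [hx]
    · intro J hJ
      refine Set.indicator_of_notMem (fun hxJ => hJ ?_) _
      exact Subtype.ext (hdisj.elim_set J.2 I.2 x hxJ hx)
  have hout : ∀ x : ℝ, (∀ I : 𝓘, x ∉ (I : Set ℝ)) → a x = 0 := by
    intro x hx
    rw [hsum x]
    simp [hx]
  have hle : ∀ x, ‖a x‖ₑ ≤ 1 := by
    intro x
    by_cases h : ∃ I : 𝓘, x ∈ (I : Set ℝ)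
    · obtain ⟨I, hI⟩ := h
      rw [hin x I hI]
      have := (ENNReal.le_tsum (f := fun I : 𝓘 => ‖c I‖ₑ ^ r) I).trans hS
      rwa [← ENNReal.one_rpow r, ENNReal.rpow_le_rpow_iff hr0] at this
    · rw [hout x (by simpa using h)]
      simp
  -- If no interval contains both points, then `a s` is either zero or the coefficient of an
  -- interval that contains `s` but not `t`.
  have half : ∀ s t : ℝ, (¬ ∃ I : 𝓘, s ∈ (I : Set ℝ) ∧ t ∈ (I : Set ℝ)) →
      ‖a s‖ₑ ^ r ≤ ∑' I : 𝓘, if s ∈ (I : Set ℝ) ∧ t ∉ (I : Set ℝ) then ‖c I‖ₑ ^ r else 0 := by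
    intro s t hst
    by_cases h : ∃ I : 𝓘, s ∈ (I : Set ℝ)
    · obtain ⟨I, hI⟩ := h
      have htI : t ∉ (I : Set ℝ) := fun ht => hst ⟨I, hI, ht⟩
      rw [hin s I hI]
      refine le_trans ?_ (ENNReal.le_tsum I)
      simp [hI, htI]
    · rw [hout s (by simpa using h)]
      simp [hr0]
  -- The increment is split into the interval entered and the interval left. If both points share an
  -- interval, both parts are zero.
  have step : ∀ s t : ℝ, ∃ α β : ℝ≥0∞, ‖a s - a t‖ₑ ≤ α + β ∧
      α ^ r ≤ (∑' I : 𝓘, if s ∈ (I : Set ℝ) ∧ t ∉ (I : Set ℝ) then ‖c I‖ₑ ^ r else 0) ∧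
      β ^ r ≤ ∑' I : 𝓘, if t ∈ (I : Set ℝ) ∧ s ∉ (I : Set ℝ) then ‖c I‖ₑ ^ r else 0 := by
    intro s t
    by_cases h : ∃ I : 𝓘, s ∈ (I : Set ℝ) ∧ t ∈ (I : Set ℝ)
    · obtain ⟨I, hs, ht⟩ := h
      exact ⟨0, 0, by simp [hin s I hs, hin t I ht], by simp [hr0], by simp [hr0]⟩
    · exact ⟨‖a s‖ₑ, ‖a t‖ₑ, enorm_sub_le, half s t h,
        half t s fun ⟨I, hI⟩ => h ⟨I, hI.symm⟩⟩
  have count : ∀ (N : ℕ) (P : Fin N → 𝓘 → Prop) [∀ i I, Decidable (P i I)], (∀ I i j, P i I → P j I → i = j) →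
      ∑ i : Fin N, ∑' I : 𝓘, (if P i I then ‖c I‖ₑ ^ r else 0) ≤ 1 := by
    intro N P _ hP
    rw [← Summable.tsum_finsetSum fun _ _ => ENNReal.summable]
    exact (ENNReal.tsum_le_tsum fun I => sum_ite_le_of_subsingleton _ _ (hP I) _).trans hS
  have hvar : variationSeminorm r a ≤ 2 := by
    refine iSup_le fun N => iSup₂_le fun t ht => ?_
    choose α β h hα hβ using step
    have mono : ∀ i j : Fin N, i < j → t i.succ ≤ t j.castSucc ∧ t i.castSucc ≤ t j.castSucc ∧
        t i.succ ≤ t j.succ ∧ t j.castSucc ≤ t j.succ ∧ t i.castSucc ≤ t i.succ := by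
      intro i j hij
      refine ⟨ht.monotone ?_, ht.monotone ?_, ht.monotone ?_, ht.monotone ?_, ht.monotone ?_⟩ <;>
      · simp only [Fin.le_def, Fin.lt_def, Fin.val_succ, Fin.val_castSucc] at *
        omega
    have one : ∀ x : ℝ≥0∞, x ≤ 1 → x ^ (1 / r) ≤ 1 := fun x hx =>
      (ENNReal.rpow_le_rpow hx (by positivity)).trans_eq (ENNReal.one_rpow _)
    calc (∑ i : Fin N, ‖a (t i.succ) - a (t i.castSucc)‖ₑ ^ r) ^ (1 / r)
        ≤ (∑ i : Fin N, (α (t i.succ) (t i.castSucc) + β (t i.succ) (t i.castSucc)) ^ r) ^ (1 / r)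
          := by
          gcongr
          exact h _ _
      _ ≤ (∑ i : Fin N, α (t i.succ) (t i.castSucc) ^ r) ^ (1 / r) +
          (∑ i : Fin N, β (t i.succ) (t i.castSucc) ^ r) ^ (1 / r) := ENNReal.Lp_add_le _ _ _ hr
      _ ≤ 1 + 1 := by
          refine add_le_add (one _ ?_) (one _ ?_)
          -- An interval entered on steps `i < j` contains `t_{i+1}` and `t_{j+1}`, hence by
          -- convexity `t_j`, so it was not entered on step `j`. The sum over `β` below is the same
          -- argument for leaving an interval.
          · refine (Finset.sum_le_sum fun i _ => hα _ _).trans (count N _ fun I i j hi hj => ?_)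
            rcases lt_trichotomy i j with hij | hij | hij
            · exact absurd ((hconn I I.2).out hi.1 hj.1 ⟨(mono i j hij).1, (mono i j hij).2.2.2.1⟩)
                hj.2
            · exact hij
            · exact absurd ((hconn I I.2).out hj.1 hi.1 ⟨(mono j i hij).1, (mono j i hij).2.2.2.1⟩)
                hi.2
          · refine (Finset.sum_le_sum fun i _ => hβ _ _).trans (count N _ fun I i j hi hj => ?_)
            rcases lt_trichotomy i j with hij | hij | hij
            · exact absurd ((hconn I I.2).out hi.1 hj.1 ⟨(mono i j hij).2.2.2.2, (mono i j hij).1⟩)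
                hi.2
            · exact hij
            · exact absurd ((hconn I I.2).out hj.1 hi.1 ⟨(mono j i hij).2.2.2.2, (mono j i hij).1⟩)
                hj.2
      _ = 2 := one_add_one_eq_two
  have hsup : eLpNorm a ∞ volume ≤ 1 := by
    rw [eLpNorm_exponent_top]
    exact essSup_le_of_ae_le _ (Eventually.of_forall hle)
  calc vENorm r a ≤ 1 + 2 := add_le_add hsup hvar
    _ = 3 := by norm_num

/-- The atomic series converges at every point, so no passage to another representative of `f` is
needed. -/
theorem vENorm_le_rENorm {r : ℝ} (hr : 1 ≤ r) (f : ℝ → E) : vENorm r f ≤ 3 * rENorm r f := by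
  have hr0 : 0 < r := by linarith
  rw [rENorm, ENNReal.mul_iInf_of_ne (by simp) (by simp)]
  refine le_iInf fun l => ?_
  rw [ENNReal.mul_iInf_of_ne (by simp) (by simp)]
  refine le_iInf fun a => ?_
  rw [ENNReal.mul_iInf_of_ne (by simp) (by simp)]
  refine le_iInf fun h => ?_
  rw [← ENNReal.tsum_mul_left]
  refine (vENorm_le_of_hasSum hr h.2.2).trans (ENNReal.tsum_le_tsum fun k => ?_)
  refine (vENorm_smul_le hr0 _ _).trans ?_
  rw [mul_comm]
  gcongr
  exact vENorm_le_of_isAtom hr (h.2.1 k)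

/-- A function that is constant on the intervals `[jδ, (j+1)δ)`, `j ∈ ℤ`, with bound `N` on the
`ℓ^r` norm of its values. -/
def IsGridStep (r : ℝ) (N : ℝ≥0∞) (a : ℝ → E) : Prop :=
  ∃ (δ : ℝ) (v : ℤ → E), 0 < δ ∧ (∀ x, a x = v ⌊x / δ⌋) ∧ (∑' j, ‖v j‖ₑ ^ r) ^ (1 / r) ≤ N

theorem IsGridStep.enorm_le {r : ℝ} (hr : 0 < r) {N : ℝ≥0∞} {a : ℝ → E} (h : IsGridStep r N a)
    (x : ℝ) : ‖a x‖ₑ ≤ N := by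
  obtain ⟨δ, v, -, ha, hN⟩ := h
  rw [ha x]
  refine le_trans ?_ hN
  have := ENNReal.rpow_le_rpow (ENNReal.le_tsum (f := fun j => ‖v j‖ₑ ^ r) ⌊x / δ⌋)
    (show 0 ≤ 1 / r by positivity)
  rwa [← ENNReal.rpow_mul, mul_one_div_cancel hr.ne', ENNReal.rpow_one] at this

theorem IsGridStep.smul {r : ℝ} (hr : 0 < r) {N : ℝ≥0∞} {a : ℝ → E} (h : IsGridStep r N a)
    (l : ℂ) : IsGridStep r (‖l‖ₑ * N) fun x => l • a x := by
  obtain ⟨δ, v, hδ, ha, hN⟩ := h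
  refine ⟨δ, fun j => l • v j, hδ, fun x => by simp only [ha x], ?_⟩
  simp only [enorm_smul, ENNReal.mul_rpow_of_nonneg _ _ hr.le]
  rw [ENNReal.tsum_mul_left, ENNReal.mul_rpow_of_nonneg _ _ (by positivity), ← ENNReal.rpow_mul,
    mul_one_div_cancel hr.ne', ENNReal.rpow_one]
  gcongr

theorem IsGridStep.isAtom {r : ℝ} {a : ℝ → E} (h : IsGridStep r 1 a) :
    IsAtom r a := by
  obtain ⟨δ, v, hδ, ha, hN⟩ := h
  set J : ℤ → Set ℝ := fun j => {x | ⌊x / δ⌋ = j} with hJ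
  have hmem : ∀ j : ℤ, (j * δ : ℝ) ∈ J j := by
    intro j
    simp [hJ, hδ.ne']
  have hinj : Function.Injective J := by
    intro i j hij
    have := hmem i
    rw [hij] at this
    exact (by simpa [hJ, hδ.ne'] using this)
  -- Atoms index their coefficients by sets, so the values `v` are carried over along the inverse of
  -- the injective map `J`.
  refine ⟨Set.range J, fun I => v (Function.invFun J I), ?_, ?_, ?_, ?_⟩
  · rintro _ ⟨j, rfl⟩
    refine ⟨fun x hx y hy z hz => ?_⟩
    simp only [hJ, Set.mem_ofPred_eq] at hx hy ⊢
    have h1 : ⌊x / δ⌋ ≤ ⌊z / δ⌋ := Int.floor_le_floor (by gcongr; exact hz.1)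
    have h2 : ⌊z / δ⌋ ≤ ⌊y / δ⌋ := Int.floor_le_floor (by gcongr; exact hz.2)
    omega
  · rintro _ ⟨i, rfl⟩ _ ⟨j, rfl⟩ hij
    refine Set.disjoint_left.2 fun x hx hy => hij ?_
    simp only [hJ, id, Set.mem_ofPred_eq] at hx hy
    rw [← hx, ← hy]
  · intro x
    rw [ha x, tsum_eq_single (⟨J ⌊x / δ⌋, ⌊x / δ⌋, rfl⟩ : Set.range J)]
    · rw [Set.indicator_of_mem (by simp [hJ])]
      simp only [Function.leftInverse_invFun hinj _]
    · rintro ⟨_, j, rfl⟩ hj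
      refine Set.indicator_of_notMem (fun hx => hj ?_) _
      simp only [hJ, Set.mem_ofPred_eq] at hx
      simp only [hx]
  · rw [← (Equiv.ofInjective J hinj).tsum_eq (fun I : Set.range J =>
      ‖v (Function.invFun J I)‖ₑ ^ r)]
    simpa only [Equiv.ofInjective_apply, Function.leftInverse_invFun hinj _] using hN

/-- Normalise: the coefficients are `N k` and the atoms `F k / N k`. If `N k = 0` then `F k`
vanishes, and the convention `0⁻¹ = 0` makes the atom zero. -/
theorem rENorm_le_of_hasSum {f : ℝ → E} {F : ℕ → ℝ → E} {N : ℕ → ℝ≥0∞} {r : ℝ} (hr : 0 < r)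
    (hF : ∀ k, IsGridStep r (N k) (F k)) (h : ∀ x, HasSum (fun k => F k x) (f x)) :
    rENorm r f ≤ ∑' k, N k := by
  by_cases hN : ∑' k, N k = ∞
  · simp [hN]
  have hNk : ∀ k, N k ≠ ∞ := ENNReal.ne_top_of_tsum_ne_top hN
  set l : ℕ → ℂ := fun k => ((N k).toReal : ℂ) with hl
  have hln : ∀ k, ‖l k‖ₑ = N k := by
    intro k
    simp [hl, ← ofReal_norm, hNk k]
  have hl0 : ∀ k, l k = 0 → N k = 0 := by
    intro k hk
    rw [← hln k, hk, enorm_zero]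
  refine iInf_le_of_le l (iInf_le_of_le (fun k x => (l k)⁻¹ • F k x) (iInf_le_of_le ?_ ?_))
  · refine ⟨?_, fun k => ?_, fun x => ?_⟩
    · simpa [hl] using ENNReal.summable_toReal hN
    · refine IsGridStep.isAtom ?_
      obtain ⟨δ, v, hδ, ha, hv⟩ := (hF k).smul hr (l k)⁻¹
      refine ⟨δ, v, hδ, ha, hv.trans ?_⟩
      by_cases hk : l k = 0
      · simp [hk]
      · rw [enorm_inv hk, hln k]
        exact ENNReal.inv_mul_le_one _
    · convert h x using 2 with k
      by_cases hk : l k = 0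
      · have := (hF k).enorm_le hr x
        rw [hl0 k hk] at this
        have : F k x = 0 := by simpa using this
        simp [hk, this]
      · rw [smul_smul, mul_inv_cancel₀ hk, one_smul]
  · simp [hln]

/-! ### Functions with a dominated modulus of continuity have `R^r` expansions -/

/-- An absolutely convergent expansion into grid step functions, of total size at most `N`. -/
def HasGridExpansion (r : ℝ) (N : ℝ≥0∞) (F : ℝ → E) : Prop :=
  ∃ (S : ℕ → ℝ → E) (n : ℕ → ℝ≥0∞), (∀ m, IsGridStep r (n m) (S m)) ∧
    (∀ x, HasSum (fun m => S m x) (F x)) ∧ ∑' m, n m ≤ N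

theorem HasGridExpansion.enorm_le {r : ℝ} (hr : 0 < r) {N : ℝ≥0∞} {F : ℝ → E}
    (h : HasGridExpansion r N F) (x : ℝ) : ‖F x‖ₑ ≤ N := by
  obtain ⟨S, n, hS, hF, hN⟩ := h
  exact ((enorm_le_tsum_of_hasSum (hF x)).trans
    (ENNReal.tsum_le_tsum fun m => (hS m).enorm_le hr x)).trans hN

/-- The double series of step functions is rearranged into a single one. This is legitimate at every
point because the `ℓ^r` size of a step function bounds its supremum and the total size is finite. -/
theorem rENorm_le_of_hasGridExpansion [CompleteSpace E] {r : ℝ} (hr : 0 < r) {N : ℕ → ℝ≥0∞}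
    {F : ℕ → ℝ → E} (hF : ∀ k, HasGridExpansion r (N k) (F k)) (hN : ∑' k, N k ≠ ∞) {f : ℝ → E}
    (hf : ∀ x, HasSum (fun k => F k x) (f x)) : rENorm r f ≤ ∑' k, N k := by
  choose S n hS hSF hn using hF
  let e : ℕ ≃ ℕ × ℕ := (Denumerable.eqv (ℕ × ℕ)).symm
  have htot : ∑' p : ℕ × ℕ, n p.1 p.2 ≤ ∑' k, N k := by
    rw [ENNReal.tsum_prod (f := fun k m => n k m)]
    exact ENNReal.tsum_le_tsum hn
  have hsum : ∀ x, HasSum (fun p : ℕ × ℕ => S p.1 p.2 x) (f x) := by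
    intro x
    have hs : Summable fun p : ℕ × ℕ => S p.1 p.2 x := by
      refine summable_of_tsum_enorm_ne_top (ne_top_of_le_ne_top hN (le_trans ?_ htot))
      exact ENNReal.tsum_le_tsum fun p => (hS p.1 p.2).enorm_le hr x
    have := hs.hasSum.prod_fiberwise fun k => hSF k x
    rw [(hf x).unique this]
    exact hs.hasSum
  calc rENorm r f ≤ ∑' i, n (e i).1 (e i).2 :=
        rENorm_le_of_hasSum (F := fun i => S (e i).1 (e i).2) hr (fun i => hS _ _)
          fun x => e.hasSum_iff.2 (hsum x)
    _ = ∑' p : ℕ × ℕ, n p.1 p.2 := e.tsum_eq fun p : ℕ × ℕ => n p.1 p.2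
    _ ≤ _ := htot

theorem setLIntegral_Ioc_rpow_le {G : ℝ → ℝ≥0∞} (hG : Measurable G) {r : ℝ} (hr : 1 ≤ r)
    (a b : ℝ) : (∫⁻ t in Set.Ioc a b, G t) ^ r ≤
      ENNReal.ofReal (b - a) ^ (r - 1) * ∫⁻ t in Set.Ioc a b, G t ^ r := by
  simpa using lintegral_rpow_le_measure (μ := volume.restrict (Set.Ioc a b)) hG.aemeasurable hr

theorem tsum_setLIntegral_Ioc_le (g : ℝ → ℝ≥0∞) (δ : ℝ) :
    ∑' j : ℤ, ∫⁻ t in Set.Ioc ((j - 1) * δ) (j * δ), g t ≤ ∫⁻ t, g t := by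
  have hd := Set.pairwise_disjoint_Ioc_add_zsmul (-δ) δ
  have he : ∀ j : ℤ, Set.Ioc ((j - 1) * δ) (j * δ) =
      Set.Ioc (-δ + j • δ) (-δ + (j + 1) • δ) := by
    intro j
    congr 1 <;> simp <;> ring
  simp_rw [he]
  rw [← lintegral_iUnion (fun j => measurableSet_Ioc) hd]
  exact setLIntegral_le_lintegral _ _

section Grid

variable {F : ℝ → E} {G H : ℝ → ℝ≥0∞} {r h : ℝ} {W A : ℝ≥0∞}

/-- Compares the grid of width `δ` with that of width `2δ`. For even `j` the two sample points
coincide; for odd `j` they are the ends of one cell of length `δ`, where Hölder applies. -/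
theorem tsum_enorm_grid_sub_rpow_le (hG : Measurable G) (hr : 1 ≤ r)
    (hFG : ∀ y x, y ≤ x → ‖F x - F y‖ₑ ≤ ∫⁻ t in Set.Ioc y x, G t) {δ : ℝ} (hδ : 0 < δ) :
    ∑' j : ℤ, ‖F (j * δ) - F (((j / 2 : ℤ) : ℝ) * (2 * δ))‖ₑ ^ r ≤
      ENNReal.ofReal δ ^ (r - 1) * ∫⁻ t, G t ^ r := by
  have hr0 : 0 < r := by linarith
  calc ∑' j : ℤ, ‖F (j * δ) - F (((j / 2 : ℤ) : ℝ) * (2 * δ))‖ₑ ^ r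
      ≤ ∑' j : ℤ, ENNReal.ofReal δ ^ (r - 1) *
          ∫⁻ t in Set.Ioc ((j - 1) * δ) (j * δ), G t ^ r := by
        refine ENNReal.tsum_le_tsum fun j => ?_
        rcases Int.emod_two_eq_zero_or_one j with hj | hj
        · have : ((j / 2 : ℤ) : ℝ) * 2 = j := by exact_mod_cast (by omega : j / 2 * 2 = j)
          rw [← mul_assoc, this]
          simp [hr0]
        · have : ((j / 2 : ℤ) : ℝ) * 2 = j - 1 := by
            exact_mod_cast (by omega : j / 2 * 2 = j - 1)
          rw [← mul_assoc, this]
          refine (ENNReal.rpow_le_rpow (hFG _ _ (by nlinarith)) hr0.le).trans ?_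
          refine (setLIntegral_Ioc_rpow_le hG hr _ _).trans_eq ?_
          congr 3
          ring
    _ ≤ _ := by
        rw [ENNReal.tsum_mul_left]
        gcongr
        exact tsum_setLIntegral_Ioc_le _ _

/-- A sampling inequality: the value at the right end of a cell is compared with the value at each
`x` of the cell and then averaged over `x`. The factor `2 ^ (r - 1)` is the convexity constant of
the `r`-th power. -/
theorem tsum_enorm_grid_rpow_le (hG : Measurable G) (hH : Measurable H) (hr : 1 ≤ r)
    (hFG : ∀ y x, y ≤ x → ‖F x - F y‖ₑ ≤ ∫⁻ t in Set.Ioc y x, G t) (hFH : ∀ x, ‖F x‖ₑ ≤ H x)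
    (δ : ℝ) :
    ENNReal.ofReal δ * ∑' j : ℤ, ‖F (j * δ)‖ₑ ^ r ≤
      2 ^ (r - 1) * ((∫⁻ t, H t ^ r) + ENNReal.ofReal δ ^ r * ∫⁻ t, G t ^ r) := by
  have hr0 : 0 < r := by linarith
  have hδr : ENNReal.ofReal δ * ENNReal.ofReal δ ^ (r - 1) = ENNReal.ofReal δ ^ r := by
    nth_rw 1 [← ENNReal.rpow_one (ENNReal.ofReal δ)]
    rw [← ENNReal.rpow_add_of_nonneg _ _ zero_le_one (by linarith)]
    simp
  have key : ∀ j : ℤ, ENNReal.ofReal δ * ‖F (j * δ)‖ₑ ^ r ≤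
      2 ^ (r - 1) * ((∫⁻ t in Set.Ioc ((j - 1) * δ) (j * δ), H t ^ r) +
        ENNReal.ofReal δ ^ r * ∫⁻ t in Set.Ioc ((j - 1) * δ) (j * δ), G t ^ r) := by
    intro j
    set I := Set.Ioc ((j - 1) * δ) (j * δ) with hI
    have hvol : volume I = ENNReal.ofReal δ := by
      rw [hI, Real.volume_Ioc]
      congr 1
      ring
    have hpt : ∀ x ∈ I, ‖F (j * δ)‖ₑ ^ r ≤
        2 ^ (r - 1) * (H x ^ r + ENNReal.ofReal δ ^ (r - 1) * ∫⁻ t in I, G t ^ r) := by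
      intro x hx
      have h1 : ‖F (j * δ)‖ₑ ≤ H x + ∫⁻ t in I, G t := by
        calc ‖F (j * δ)‖ₑ = ‖F x + (F (j * δ) - F x)‖ₑ := by rw [add_sub_cancel]
          _ ≤ ‖F x‖ₑ + ‖F (j * δ) - F x‖ₑ := enorm_add_le _ _
          _ ≤ H x + ∫⁻ t in I, G t := by
            refine add_le_add (hFH x) ((hFG x _ hx.2).trans ?_)
            exact lintegral_mono_set (Set.Ioc_subset_Ioc_left hx.1.le)
      refine (ENNReal.rpow_le_rpow h1 hr0.le).trans
        ((ENNReal.rpow_add_le_mul_rpow_add_rpow _ _ hr).trans ?_)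
      gcongr
      refine (setLIntegral_Ioc_rpow_le hG hr _ _).trans_eq ?_
      congr 3
      ring
    calc ENNReal.ofReal δ * ‖F (j * δ)‖ₑ ^ r = ∫⁻ _ in I, ‖F (j * δ)‖ₑ ^ r := by
          rw [setLIntegral_const, hvol, mul_comm]
      _ ≤ ∫⁻ x in I, 2 ^ (r - 1) * (H x ^ r + ENNReal.ofReal δ ^ (r - 1) * ∫⁻ t in I, G t ^ r) :=
          setLIntegral_mono' measurableSet_Ioc hpt
      _ = _ := by
          rw [lintegral_const_mul _ (f := fun x => H x ^ r + _)
              ((hH.pow_const r).add measurable_const),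
            lintegral_add_right _ measurable_const, setLIntegral_const, hvol, ← hδr]
          ring
  rw [← ENNReal.tsum_mul_left]
  refine (ENNReal.tsum_le_tsum key).trans ?_
  rw [ENNReal.tsum_mul_left, ENNReal.tsum_add, ENNReal.tsum_mul_left]
  gcongr <;> exact tsum_setLIntegral_Ioc_le _ _

/-- The sample point lies within one mesh width `δ` of `x`, so by Hölder the error is at most `δ^{1
- 1/r} ‖G‖_r`; this tends to zero since `r > 1`. -/
theorem tendsto_grid (hG : Measurable G) (hr : 1 < r)
    (hFG : ∀ y x, y ≤ x → ‖F x - F y‖ₑ ≤ ∫⁻ t in Set.Ioc y x, G t)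
    (hGr : ∫⁻ t, G t ^ r ≠ ∞) (hh : 0 < h) (x : ℝ) :
    Tendsto (fun m : ℕ => F (⌊x / (h / 2 ^ m)⌋ * (h / 2 ^ m))) atTop (𝓝 (F x)) := by
  have hr0 : 0 < r := by linarith
  rw [tendsto_iff_edist_tendsto_0]
  have hδ : ∀ m : ℕ, 0 < h / 2 ^ m := fun m => by positivity
  have bound : ∀ m : ℕ, edist (F (⌊x / (h / 2 ^ m)⌋ * (h / 2 ^ m))) (F x) ≤
      (ENNReal.ofReal (h / 2 ^ m) ^ (r - 1) * ∫⁻ t, G t ^ r) ^ (1 / r) := by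
    intro m
    set δ := h / 2 ^ m with hδ'
    have h1 : ⌊x / δ⌋ * δ ≤ x := (le_div_iff₀ (hδ m)).1 (Int.floor_le _)
    have h2 : x - ⌊x / δ⌋ * δ ≤ δ := by
      have := (div_lt_iff₀ (hδ m)).1 (Int.lt_floor_add_one (x / δ))
      linarith
    rw [edist_comm, edist_eq_enorm_sub, one_div, ENNReal.le_rpow_inv_iff hr0]
    refine (ENNReal.rpow_le_rpow (hFG _ _ h1) hr0.le).trans
      ((setLIntegral_Ioc_rpow_le hG hr.le _ _).trans ?_)
    gcongr
    exact Measure.restrict_le_self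
  refine tendsto_of_tendsto_of_tendsto_of_le_of_le tendsto_const_nhds ?_ (fun _ => zero_le) bound
  have h0 : Tendsto (fun m : ℕ => h / 2 ^ m) atTop (𝓝 0) :=
    tendsto_const_nhds.div_atTop (tendsto_pow_atTop_atTop_of_one_lt one_lt_two)
  have h1 : Tendsto (fun m : ℕ => ENNReal.ofReal (h / 2 ^ m) ^ (r - 1)) atTop (𝓝 0) := by
    have := (ENNReal.continuous_rpow_const (y := r - 1)).tendsto (ENNReal.ofReal 0)
    simp only [ENNReal.ofReal_zero, ENNReal.zero_rpow_of_pos (sub_pos.2 hr)] at this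
    refine this.comp ?_
    simpa using ENNReal.tendsto_ofReal h0
  have h2 := ENNReal.Tendsto.mul_const h1 (Or.inr hGr)
  rw [zero_mul] at h2
  have h3 := ((ENNReal.continuous_rpow_const (y := 1 / r)).tendsto 0).comp h2
  rwa [ENNReal.zero_rpow_of_pos (by positivity)] at h3

/-- The ratio of the sizes of consecutive terms in the dyadic expansion. -/
def gridRatio (r : ℝ) : ℝ≥0∞ := ENNReal.ofReal ((1 / 2) ^ (1 - 1 / r))

theorem gridRatio_lt_one (hr : 1 < r) : gridRatio r < 1 := by
  rw [gridRatio, ENNReal.ofReal_lt_one]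
  refine Real.rpow_lt_one (by norm_num) (by norm_num) ?_
  rw [sub_pos, div_lt_one (by linarith)]
  exact hr

theorem gridRatio_pow_rpow (hr : 1 < r) (m : ℕ) :
    (gridRatio r ^ m) ^ r = ENNReal.ofReal ((1 / 2) ^ m) ^ (r - 1) := by
  have hr0 : 0 < r := by linarith
  have hq : (0 : ℝ) ≤ (1 / 2) ^ (1 - 1 / r) := by positivity
  rw [gridRatio, ← ENNReal.ofReal_pow hq,
    ENNReal.ofReal_rpow_of_nonneg (pow_nonneg hq _) hr0.le,
    ENNReal.ofReal_rpow_of_nonneg (by positivity : (0 : ℝ) ≤ (1 / 2) ^ m) (by linarith)]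
  congr 1
  rw [← Real.rpow_natCast, ← Real.rpow_natCast, ← Real.rpow_mul (by positivity),
    ← Real.rpow_mul (by norm_num), ← Real.rpow_mul (by norm_num)]
  congr 1
  field_simp

/-- The dyadic expansion of a function `F` whose increments are dominated by the integral of `G`,
starting from the grid of width `h`. -/
theorem hasGridExpansion_of_enorm_sub_le [CompleteSpace E] (hG : Measurable G) (hH : Measurable H)
    (hr : 1 < r) (hFG : ∀ y x, y ≤ x → ‖F x - F y‖ₑ ≤ ∫⁻ t in Set.Ioc y x, G t)
    (hFH : ∀ x, ‖F x‖ₑ ≤ H x) (hh : 0 < h) (hW : W ^ r * ENNReal.ofReal h = 1) (hA : A ≠ ∞)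
    (hHA : ∫⁻ t, H t ^ r ≤ A ^ r) (hGA : ENNReal.ofReal h ^ r * ∫⁻ t, G t ^ r ≤ A ^ r) :
    HasGridExpansion r (2 * (1 - gridRatio r)⁻¹ * (W * A)) F := by
  have hr0 : 0 < r := by linarith
  have hh0 : ENNReal.ofReal h ≠ 0 := by simpa using hh
  have hWtop : W ≠ ∞ := by
    rintro rfl
    rw [ENNReal.top_rpow_of_pos hr0, ENNReal.top_mul hh0] at hW
    exact ENNReal.top_ne_one hW
  have hGr : ∫⁻ t, G t ^ r ≠ ∞ := by
    intro hc
    rw [hc, ENNReal.mul_top (by simp [hh])] at hGA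
    exact ENNReal.rpow_ne_top_of_nonneg hr0.le hA (top_le_iff.1 hGA)
  -- Here `W` plays the role of `h^{-1/r}`: it converts a bound for `h` times a sum of `r`-th powers
  -- into one for the `ℓ^r` norm.
  have root : ∀ (c T : ℝ≥0∞), ENNReal.ofReal h * T ≤ (c * A) ^ r → T ^ (1 / r) ≤ c * (W * A) := by
    intro c T hT
    rw [one_div, ENNReal.rpow_inv_le_iff hr0]
    calc T = W ^ r * (ENNReal.ofReal h * T) := by rw [← mul_assoc, hW, one_mul]
      _ ≤ W ^ r * (c * A) ^ r := by gcongr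
      _ = (c * (W * A)) ^ r := by
        rw [← ENNReal.mul_rpow_of_nonneg _ _ hr0.le]
        congr 1
        ring
  let P : ℕ → ℝ → E := fun m x => F (⌊x / (h / 2 ^ m)⌋ * (h / 2 ^ m))
  -- The coarsest sampling followed by the successive corrections, so that the partial sums
  -- telescope to `P m`.
  let S : ℕ → ℝ → E := fun m x => if m = 0 then P 0 x else P m x - P (m - 1) x
  have hS : ∀ m, IsGridStep r (2 * (W * A) * gridRatio r ^ m) (S m) := by
    intro m
    rcases m with _ | m
    · refine ⟨h, fun j => F (j * h), hh, fun x => by simp [S, P], ?_⟩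
      rw [pow_zero, mul_one]
      refine root _ _ ((tsum_enorm_grid_rpow_le hG hH hr.le hFG hFH h).trans ?_)
      calc (2 : ℝ≥0∞) ^ (r - 1) * ((∫⁻ t, H t ^ r) + ENNReal.ofReal h ^ r * ∫⁻ t, G t ^ r)
          ≤ 2 ^ (r - 1) * (A ^ r + A ^ r) := by gcongr
        _ = (2 * A) ^ r := by
          rw [← two_mul, ENNReal.mul_rpow_of_nonneg _ _ hr0.le, ← mul_assoc]
          congr 1
          nth_rw 2 [← ENNReal.rpow_one 2]
          rw [← ENNReal.rpow_add_of_nonneg _ _ (by linarith) zero_le_one]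
          simp
    · have hδ : 0 < h / 2 ^ (m + 1) := by positivity
      -- The cell `j` of the finer grid lies in the cell `j / 2` (integer division) of the coarser
      -- one, so the correction is constant on the finer cells.
      refine ⟨h / 2 ^ (m + 1), fun j => F (j * (h / 2 ^ (m + 1))) -
        F (((j / 2 : ℤ) : ℝ) * (2 * (h / 2 ^ (m + 1)))), hδ, fun x => ?_, ?_⟩
      · have e1 : 2 * (h / 2 ^ (m + 1)) = h / 2 ^ m := by field_simp; ring
        have e2 : ⌊x / (h / 2 ^ (m + 1))⌋ / 2 = ⌊x / (h / 2 ^ m)⌋ := by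
          rw [← e1]
          have := Int.floor_div_natCast (x / (h / 2 ^ (m + 1))) 2
          rw [Nat.cast_ofNat, Nat.cast_ofNat] at this
          rw [← this]
          congr 1
          field_simp
        simp only [S, P, Nat.succ_ne_zero, if_false, Nat.add_sub_cancel, e1, e2]
      · have : (∑' j : ℤ, ‖F (j * (h / 2 ^ (m + 1))) -
            F (((j / 2 : ℤ) : ℝ) * (2 * (h / 2 ^ (m + 1))))‖ₑ ^ r) ^ (1 / r) ≤
            gridRatio r ^ (m + 1) * (W * A) := by
          refine root _ _ ?_
          rw [ENNReal.mul_rpow_of_nonneg _ _ hr0.le, gridRatio_pow_rpow hr]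
          refine (mul_le_mul_right (tsum_enorm_grid_sub_rpow_le hG hr.le hFG hδ) _).trans ?_
          calc ENNReal.ofReal h *
                (ENNReal.ofReal (h / 2 ^ (m + 1)) ^ (r - 1) * ∫⁻ t, G t ^ r)
              = ENNReal.ofReal ((1 / 2) ^ (m + 1)) ^ (r - 1) *
                (ENNReal.ofReal h ^ r * ∫⁻ t, G t ^ r) := by
                have : h / 2 ^ (m + 1) = (1 / 2) ^ (m + 1) * h := by
                  rw [div_pow, one_pow]; ring
                rw [this, ENNReal.ofReal_mul (by positivity),
                  ENNReal.mul_rpow_of_nonneg _ _ (by linarith)]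
                have : ENNReal.ofReal h ^ r =
                    ENNReal.ofReal h * ENNReal.ofReal h ^ (r - 1) := by
                  nth_rw 2 [← ENNReal.rpow_one (ENNReal.ofReal h)]
                  rw [← ENNReal.rpow_add_of_nonneg _ _ zero_le_one (by linarith)]
                  simp
                rw [this]
                ring
            _ ≤ _ := by gcongr
        -- The factor `2` is needed only for the coarsest term; here it is given away to keep one
        -- formula for all `m`.
        refine this.trans ?_
        rw [mul_comm, mul_assoc 2, two_mul]
        exact le_self_add
  have htot : ∑' m, 2 * (W * A) * gridRatio r ^ m = 2 * (1 - gridRatio r)⁻¹ * (W * A) := by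
    rw [ENNReal.tsum_mul_left, ENNReal.tsum_geometric]
    ring
  refine ⟨S, _, hS, fun x => ?_, htot.le⟩
  have hs : Summable fun m => S m x := by
    refine summable_of_tsum_enorm_ne_top (ne_top_of_le_ne_top ?_
      (ENNReal.tsum_le_tsum fun m => (hS m).enorm_le hr0 x))
    rw [htot]
    refine ENNReal.mul_ne_top (ENNReal.mul_ne_top (by simp) ?_) (ENNReal.mul_ne_top hWtop hA)
    simpa [tsub_eq_zero_iff_le] using gridRatio_lt_one hr
  refine hs.hasSum_iff_tendsto_nat.2 ((tendsto_add_atTop_iff_nat 1).1 ?_)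
  have hpart : ∀ m, ∑ i ∈ Finset.range (m + 1), S i x = P m x := by
    intro m
    induction m with
    | zero => simp [S]
    | succ m ih => rw [Finset.sum_range_succ, ih]; simp [S]
  simp only [hpart]
  exact tendsto_grid hG hr hFG hGr hh x

end Grid

/-! ### Translates of functions of bounded variation -/

theorem tsum_enorm_sub_rpow_le_variationSeminorm {r : ℝ} (hr : 0 < r) (f : ℝ → E) {y : ℝ}
    (hy : 0 < y) (x : ℝ) :
    ∑' j : ℤ, ‖f (x + j * y - y) - f (x + j * y)‖ₑ ^ r ≤ variationSeminorm r f ^ r := by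
  rw [ENNReal.tsum_eq_iSup_sum]
  refine iSup_le fun s => ?_
  set n : ℕ := s.sup Int.natAbs with hn
  -- The points run from `x - (n + 1) y` to `x + n y`, so that the `i`-th step of the partition ends
  -- at `x + (i - n) y` and every index in `s` occurs.
  let t : Fin (2 * n + 1 + 1) → ℝ := fun i => x + ((i : ℝ) - n - 1) * y
  have ht : StrictMono t := by
    intro i j hij
    have : ((i : ℕ) : ℝ) < (j : ℕ) := by exact_mod_cast hij
    simp only [t]
    gcongr
  let ι : Fin (2 * n + 1) → ℤ := fun i => (i : ℤ) - n
  have hι : Function.Injective ι := by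
    intro i j hij
    simp only [ι] at hij
    exact Fin.ext (by omega)
  have hs : s ⊆ Finset.univ.image ι := by
    intro j hj
    have : j.natAbs ≤ n := Finset.le_sup (f := Int.natAbs) hj
    refine Finset.mem_image.2 ⟨⟨(j + n).toNat, by omega⟩, Finset.mem_univ _, ?_⟩
    simp only [ι]
    omega
  have key : (∑ i : Fin (2 * n + 1), ‖f (t i.succ) - f (t i.castSucc)‖ₑ ^ r) ^ (1 / r) ≤
      variationSeminorm r f := le_iSup_of_le _ (le_iSup₂_of_le t ht le_rfl)
  rw [one_div, ENNReal.rpow_inv_le_iff hr] at key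
  refine le_trans ?_ key
  refine (Finset.sum_le_sum_of_subset hs).trans ?_
  rw [Finset.sum_image hι.injOn]
  refine Finset.sum_le_sum fun i _ => ?_
  have e1 : x + (ι i : ℝ) * y = t i.succ := by
    simp only [ι, t, Fin.val_succ]
    push_cast
    ring
  have e2 : x + (ι i : ℝ) * y - y = t i.castSucc := by
    simp only [ι, t, Fin.val_castSucc]
    push_cast
    ring
  rw [e2, e1, ← enorm_neg, neg_sub]

theorem lintegral_eq_setLIntegral_tsum {g : ℝ → ℝ≥0∞} (hg : AEMeasurable g) {y : ℝ} (hy : 0 < y) :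
    ∫⁻ x, g x = ∫⁻ x in Set.Ioc 0 y, ∑' j : ℤ, g (x + j * y) := by
  have hshift : ∀ j : ℤ, ∫⁻ x in Set.Ioc (j • y) ((j + 1) • y), g x =
      ∫⁻ x in Set.Ioc 0 y, g (x + j * y) := by
    intro j
    have := (measurePreserving_add_right volume ((j : ℝ) * y)).setLIntegral_comp_emb
      (measurableEmbedding_addRight _) g (Set.Ioc 0 y)
    rw [this]
    congr 2
    simp [add_mul, add_comm]
  rw [lintegral_tsum]
  · simp_rw [← hshift]
    rw [← lintegral_iUnion (fun j => measurableSet_Ioc) (Set.pairwise_disjoint_Ioc_zsmul y),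
      iUnion_Ioc_zsmul hy, Measure.restrict_univ]
  · intro j
    exact (hg.comp_quasiMeasurePreserving
      (measurePreserving_add_right volume ((j : ℝ) * y)).quasiMeasurePreserving).restrict

/-- Folding the line onto `(0, y]` turns the integrand into the sum of increments along a lattice of
step `y`, which is a variation sum; the length of the period supplies the factor `|y|`. A
translation reverses the sign of `y`. -/
theorem lintegral_enorm_translate_sub_rpow_le {r : ℝ} (hr : 0 < r) {f : ℝ → E}
    (hf : AEStronglyMeasurable f) (y : ℝ) :
    ∫⁻ x, ‖f (x - y) - f x‖ₑ ^ r ≤ ENNReal.ofReal |y| * variationSeminorm r f ^ r := by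
  have pos : ∀ y : ℝ, 0 < y →
      ∫⁻ x, ‖f (x - y) - f x‖ₑ ^ r ≤ ENNReal.ofReal |y| * variationSeminorm r f ^ r := by
    intro y hy
    have hm : AEMeasurable fun x => ‖f (x - y) - f x‖ₑ ^ r :=
      (((hf.comp_quasiMeasurePreserving
        (measurePreserving_sub_right volume y).quasiMeasurePreserving).sub hf).enorm).pow_const r
    rw [lintegral_eq_setLIntegral_tsum hm hy]
    calc ∫⁻ x in Set.Ioc 0 y, ∑' j : ℤ, ‖f (x + j * y - y) - f (x + j * y)‖ₑ ^ r
        ≤ ∫⁻ _ in Set.Ioc 0 y, variationSeminorm r f ^ r :=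
          lintegral_mono fun x => tsum_enorm_sub_rpow_le_variationSeminorm hr f hy x
      _ = _ := by
          rw [setLIntegral_const, Real.volume_Ioc, sub_zero, abs_of_pos hy, mul_comm]
  rcases lt_trichotomy y 0 with hy | rfl | hy
  · rw [← lintegral_add_right_eq_self _ y, ← abs_neg]
    refine le_trans (le_of_eq (lintegral_congr fun x => ?_)) (pos (-y) (by linarith))
    rw [add_sub_cancel_right, sub_neg_eq_add, ← enorm_neg, neg_sub]
  · simp [hr]
  · exact pos y hy

/-- Jensen with weight `k` followed by Tonelli reduces to single translates, whose factor `|y|`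
produces the first moment of `k`. -/
theorem lintegral_convolution_translate_sub_rpow_le {r : ℝ} (hr : 1 ≤ r) {f : ℝ → E}
    (hf : AEStronglyMeasurable f) {k : ℝ → ℝ≥0∞} (hk : Measurable k) :
    ∫⁻ x, (∫⁻ y, k y * ‖f (x - y) - f x‖ₑ) ^ r ≤
      (∫⁻ y, k y) ^ (r - 1) * (∫⁻ y, k y * ENNReal.ofReal |y|) * variationSeminorm r f ^ r := by
  have hr0 : 0 < r := by linarith
  have hfs : AEStronglyMeasurable (fun p : ℝ × ℝ => f (p.1 - p.2) - f p.1)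
      (volume.prod volume) :=
    (hf.comp_quasiMeasurePreserving
      (quasiMeasurePreserving_sub_of_right_invariant volume volume)).sub hf.comp_fst
  have hm : AEMeasurable (Function.uncurry fun x y : ℝ => k y * ‖f (x - y) - f x‖ₑ ^ r)
      (volume.prod volume) :=
    (hk.comp measurable_snd).aemeasurable.mul (hfs.enorm.pow_const r)
  have hfy : ∀ x, AEMeasurable fun y => ‖f (x - y) - f x‖ₑ := fun x =>
    ((hf.comp_quasiMeasurePreserving (quasiMeasurePreserving_sub_left volume x)).sub
      aestronglyMeasurable_const).enorm
  have hfx : ∀ y, AEMeasurable fun x => ‖f (x - y) - f x‖ₑ := fun y =>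
    ((hf.comp_quasiMeasurePreserving
      (measurePreserving_sub_right volume y).quasiMeasurePreserving).sub hf).enorm
  calc ∫⁻ x, (∫⁻ y, k y * ‖f (x - y) - f x‖ₑ) ^ r
      ≤ ∫⁻ x, (∫⁻ y, k y) ^ (r - 1) * ∫⁻ y, k y * ‖f (x - y) - f x‖ₑ ^ r :=
        lintegral_mono fun x => lintegral_mul_rpow_le hk.aemeasurable (hfy x) hr
    _ = (∫⁻ y, k y) ^ (r - 1) * ∫⁻ y, k y * ∫⁻ x, ‖f (x - y) - f x‖ₑ ^ r := by
        rw [lintegral_const_mul'' _ (f := fun x => ∫⁻ y, k y * ‖f (x - y) - f x‖ₑ ^ r)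
          hm.lintegral_prod_right', lintegral_lintegral_swap hm]
        congr 1
        refine lintegral_congr fun y => ?_
        rw [lintegral_const_mul'' _ ((hfx y).pow_const r)]
    _ ≤ (∫⁻ y, k y) ^ (r - 1) *
        ∫⁻ y, k y * (ENNReal.ofReal |y| * variationSeminorm r f ^ r) := by
        gcongr with y
        exact lintegral_enorm_translate_sub_rpow_le hr0 hf y
    _ = _ := by
        simp only [← mul_assoc (k _)]
        rw [lintegral_mul_const _ (f := fun y => k y * ENNReal.ofReal |y|)
          (hk.mul (by fun_prop)), mul_assoc]

/-! ### Convolution with an integrable bounded kernel -/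

theorem eLpNorm_ofReal_rpow {r : ℝ} (hr : 0 < r) (f : ℝ → E) :
    eLpNorm f (ENNReal.ofReal r) volume ^ r = ∫⁻ x, ‖f x‖ₑ ^ r := by
  rw [eLpNorm_eq_lintegral_rpow_enorm_toReal (by simpa using hr) ENNReal.ofReal_ne_top,
    ENNReal.toReal_ofReal hr.le, ← ENNReal.rpow_mul, one_div_mul_cancel hr.ne', ENNReal.rpow_one]

theorem le_one_add_rpow {r : ℝ} (hr : 1 ≤ r) (a : ℝ≥0∞) : a ≤ 1 + a ^ r := by
  rcases le_total a 1 with h | h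
  · exact h.trans le_self_add
  · calc a = a ^ (1 : ℝ) := (ENNReal.rpow_one a).symm
      _ ≤ a ^ r := ENNReal.rpow_le_rpow_of_exponent_le h hr
      _ ≤ _ := le_add_self

/-- Only finiteness matters here, so `g ≤ 1 + g^r` replaces Hölder. It treats `r = 1` alike and
needs no measurability of `g`. -/
theorem lintegral_mul_lt_top {k g : ℝ → ℝ≥0∞} (hk : Measurable k) {r : ℝ} (hr : 1 ≤ r)
    (hk1 : ∫⁻ x, k x ≠ ∞) {B : ℝ≥0∞} (hB : B ≠ ∞) (hkB : ∀ x, k x ≤ B)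
    (hg : ∫⁻ x, g x ^ r ≠ ∞) : ∫⁻ x, k x * g x < ∞ := by
  calc ∫⁻ x, k x * g x ≤ ∫⁻ x, (k x + B * g x ^ r) := by
        refine lintegral_mono fun x => ?_
        calc k x * g x ≤ k x * (1 + g x ^ r) := by gcongr; exact le_one_add_rpow hr _
          _ = k x + k x * g x ^ r := by rw [mul_add, mul_one]
          _ ≤ k x + B * g x ^ r := by gcongr; exact hkB x
    _ = (∫⁻ x, k x) + B * ∫⁻ x, g x ^ r := by
        rw [lintegral_add_left hk, lintegral_const_mul' _ _ hB]
    _ < ∞ := ENNReal.add_lt_top.2 ⟨hk1.lt_top, ENNReal.mul_lt_top hB.lt_top hg.lt_top⟩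

/-- A continuous, integrable and bounded kernel. -/
structure IsKernel (K : ℝ → ℂ) : Prop where
  continuous : Continuous K
  lintegral_ne_top : ∫⁻ x, ‖K x‖ₑ ≠ ∞
  bounded : ∃ B : ℝ≥0∞, B ≠ ∞ ∧ ∀ x, ‖K x‖ₑ ≤ B

theorem isKernel_schwartzMap (g : 𝓢(ℝ, ℂ)) : IsKernel g where
  continuous := g.continuous
  lintegral_ne_top := g.integrable.hasFiniteIntegral.ne
  bounded := ⟨ENNReal.ofReal (SchwartzMap.seminorm ℝ 0 0 g), ENNReal.ofReal_ne_top, fun x => by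
    rw [← ofReal_norm]
    exact ENNReal.ofReal_le_ofReal (g.norm_le_seminorm ℝ x)⟩

section Convolution

variable {K : ℝ → ℂ} {r : ℝ} {f : ℝ → E}

theorem lintegral_enorm_rpow_ne_top (hr : 0 < r) (hf : MemLp f (ENNReal.ofReal r)) :
    ∫⁻ x, ‖f x‖ₑ ^ r ≠ ∞ := by
  rw [← eLpNorm_ofReal_rpow hr]
  exact ENNReal.rpow_ne_top_of_nonneg hr.le hf.2.ne

theorem IsKernel.integrable_smul (hK : IsKernel K) (hr : 1 ≤ r)
    (hf : MemLp f (ENNReal.ofReal r)) : Integrable fun x => K x • f x := by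
  obtain ⟨B, hB, hKB⟩ := hK.bounded
  refine ⟨hK.continuous.aestronglyMeasurable.smul hf.1, ?_⟩
  simp only [HasFiniteIntegral, enorm_smul]
  exact lintegral_mul_lt_top hK.continuous.enorm.measurable hr hK.lintegral_ne_top hB hKB
    (lintegral_enorm_rpow_ne_top (by linarith) hf)

theorem IsKernel.comp_sub_left (hK : IsKernel K) (x : ℝ) : IsKernel fun y => K (x - y) where
  continuous := hK.continuous.comp (by fun_prop)
  lintegral_ne_top := by
    rw [lintegral_sub_left_eq_self fun y => ‖K y‖ₑ]
    exact hK.lintegral_ne_top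
  bounded := by
    obtain ⟨B, hB, hKB⟩ := hK.bounded
    exact ⟨B, hB, fun y => hKB _⟩

/-- The convolution of a scalar kernel with an `E`-valued function. -/
def conv (K : ℝ → ℂ) (f : ℝ → E) (x : ℝ) : E := ∫ y, K (x - y) • f y

theorem IsKernel.integrable_conv (hK : IsKernel K) (hr : 1 ≤ r)
    (hf : MemLp f (ENNReal.ofReal r)) (x : ℝ) : Integrable fun y => K (x - y) • f y :=
  (hK.comp_sub_left x).integrable_smul hr hf

theorem enorm_conv_le (K : ℝ → ℂ) (f : ℝ → E) (x : ℝ) :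
    ‖conv K f x‖ₑ ≤ ∫⁻ y, ‖K (x - y)‖ₑ * ‖f y‖ₑ := by
  refine (enorm_integral_le_lintegral_enorm _).trans_eq ?_
  simp only [enorm_smul]

theorem aestronglyMeasurable_conv (hK : Continuous K) (hf : AEStronglyMeasurable f) :
    AEStronglyMeasurable (conv K f) :=
  AEStronglyMeasurable.integral_prod_right' (f := fun p : ℝ × ℝ => K (p.1 - p.2) • f p.2)
    ((hK.comp (by fun_prop)).aestronglyMeasurable.smul hf.comp_snd)

theorem lintegral_conv_rpow_le (hK : Continuous K) (hr : 1 ≤ r) (hf : AEStronglyMeasurable f) :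
    ∫⁻ x, (∫⁻ y, ‖K (x - y)‖ₑ * ‖f y‖ₑ) ^ r ≤
      ((∫⁻ x, ‖K x‖ₑ) * eLpNorm f (ENNReal.ofReal r) volume) ^ r := by
  rw [ENNReal.mul_rpow_of_nonneg _ _ (by linarith), eLpNorm_ofReal_rpow (by linarith)]
  exact lintegral_convolution_rpow_le hK.enorm.measurable hf.enorm hr

theorem eLpNorm_conv_le (hK : Continuous K) (hr : 1 ≤ r) (hf : AEStronglyMeasurable f) :
    eLpNorm (conv K f) (ENNReal.ofReal r) volume ≤
      (∫⁻ x, ‖K x‖ₑ) * eLpNorm f (ENNReal.ofReal r) volume := by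
  have hr0 : 0 < r := by linarith
  rw [← ENNReal.rpow_le_rpow_iff hr0, eLpNorm_ofReal_rpow hr0]
  refine le_trans (lintegral_mono fun x => ?_) (lintegral_conv_rpow_le hK hr hf)
  gcongr
  exact enorm_conv_le K f x

theorem IsKernel.memLp_conv (hK : IsKernel K) (hr : 1 ≤ r) (hf : MemLp f (ENNReal.ofReal r)) :
    MemLp (conv K f) (ENNReal.ofReal r) :=
  ⟨aestronglyMeasurable_conv hK.continuous hf.1,
    (eLpNorm_conv_le hK.continuous hr hf.1).trans_lt
      (ENNReal.mul_lt_top hK.lintegral_ne_top.lt_top hf.2)⟩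

/-- The increments of a convolution are dominated by the convolution with the derivative. -/
theorem IsKernel.enorm_conv_sub_le (hK : IsKernel K) {K' : ℝ → ℂ} (hK' : Continuous K')
    (hd : ∀ x, HasDerivAt K (K' x) x) (hr : 1 ≤ r) (hf : MemLp f (ENNReal.ofReal r)) {y x : ℝ}
    (hyx : y ≤ x) :
    ‖conv K f x - conv K f y‖ₑ ≤ ∫⁻ t in Set.Ioc y x, ∫⁻ z, ‖K' (t - z)‖ₑ * ‖f z‖ₑ := by
  have hm : AEMeasurable (Function.uncurry fun t z : ℝ => ‖K' (t - z)‖ₑ * ‖f z‖ₑ)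
      ((volume.restrict (Set.Ioc y x)).prod volume) :=
    ((hK'.comp (by fun_prop)).enorm.measurable.aemeasurable).mul hf.1.enorm.comp_snd
  have hKK : ∀ z, ‖K (x - z) - K (y - z)‖ₑ ≤ ∫⁻ t in Set.Ioc y x, ‖K' (t - z)‖ₑ := by
    intro z
    have hftc : ∫ t in y..x, K' (t - z) = K (x - z) - K (y - z) := by
      refine intervalIntegral.integral_eq_sub_of_hasDerivAt (f := fun t => K (t - z))
        (fun t _ => ?_) ((hK'.comp (by fun_prop)).intervalIntegrable _ _)
      exact (hd (t - z)).comp_sub_const t z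
    rw [← hftc, intervalIntegral.integral_of_le hyx]
    exact enorm_integral_le_lintegral_enorm _
  calc ‖conv K f x - conv K f y‖ₑ = ‖∫ z, (K (x - z) - K (y - z)) • f z‖ₑ := by
        rw [conv, conv, ← integral_sub (hK.integrable_conv hr hf x) (hK.integrable_conv hr hf y)]
        simp only [sub_smul]
    _ ≤ ∫⁻ z, ‖K (x - z) - K (y - z)‖ₑ * ‖f z‖ₑ := by
        refine (enorm_integral_le_lintegral_enorm _).trans_eq ?_
        simp only [enorm_smul]
    _ ≤ ∫⁻ z, ∫⁻ t in Set.Ioc y x, ‖K' (t - z)‖ₑ * ‖f z‖ₑ := by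
        refine lintegral_mono fun z => ?_
        rw [lintegral_mul_const' _ _ enorm_ne_top]
        gcongr
        exact hKK z
    _ = _ := (lintegral_lintegral_swap hm).symm

/-- Convolution with a kernel is dual to convolution with the reflected kernel. -/
theorem IsKernel.integral_smul_conv [CompleteSpace E] (hK : IsKernel K) (hr : 1 ≤ r)
    (hf : MemLp f (ENNReal.ofReal r)) (g : 𝓢(ℝ, ℂ)) :
    ∫ y, g y • conv K f y = ∫ x, (∫ y, K (y - x) * g y) • f x := by
  have hr0 : 0 < r := by linarith
  have hint : Integrable (Function.uncurry fun y x : ℝ => g y • K (y - x) • f x)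
      (volume.prod volume) := by
    have hm : AEStronglyMeasurable (Function.uncurry fun y x : ℝ => g y • K (y - x) • f x)
        (volume.prod volume) :=
      (g.continuous.comp continuous_fst).aestronglyMeasurable.smul
        ((hK.continuous.comp (by fun_prop)).aestronglyMeasurable.smul hf.1.comp_snd)
    refine ⟨hm, ?_⟩
    rw [HasFiniteIntegral, lintegral_prod _ hm.enorm]
    have e : ∀ y, ∫⁻ x, ‖(Function.uncurry fun y x : ℝ => g y • K (y - x) • f x) (y, x)‖ₑ =
        ‖g y‖ₑ * ∫⁻ x, ‖K (y - x)‖ₑ * ‖f x‖ₑ := by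
      intro y
      rw [← lintegral_const_mul' _ _ enorm_ne_top]
      simp only [Function.uncurry_apply_pair, enorm_smul]
    simp only [e]
    obtain ⟨B, hB, hgB⟩ := (isKernel_schwartzMap g).bounded
    -- The inner integral is the convolution of `‖K‖` with `‖f‖`, which has finite `L^r` norm by
    -- Young's inequality.
    refine lintegral_mul_lt_top g.continuous.enorm.measurable hr
      (isKernel_schwartzMap g).lintegral_ne_top hB hgB (ne_top_of_le_ne_top ?_
        (lintegral_conv_rpow_le hK.continuous hr hf.1))
    exact ENNReal.rpow_ne_top_of_nonneg hr0.le (ENNReal.mul_ne_top hK.lintegral_ne_top hf.2.ne)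
  calc ∫ y, g y • conv K f y = ∫ y, ∫ x, g y • K (y - x) • f x := by
        refine integral_congr_ae (Eventually.of_forall fun y => ?_)
        simp only [conv, integral_smul]
    _ = ∫ x, ∫ y, g y • K (y - x) • f x := integral_integral_swap hint
    _ = _ := by
        refine integral_congr_ae (Eventually.of_forall fun x => ?_)
        simp only [smul_smul]
        rw [integral_smul_const]
        simp only [mul_comm]

end Convolution

/-! ### Cutoffs in frequency -/

/-- The cutoff to frequencies of size at most about `2 ^ n`. -/
def cutoff (φ : 𝓢(ℝ, ℂ)) (n : ℕ) (ξ : ℝ) : ℂ := (𝓕 φ) ((2 ^ n)⁻¹ * ξ)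

/-- The convolution kernel of the multiplier `cutoff φ n`. -/
def kernel (φ : 𝓢(ℝ, ℂ)) (n : ℕ) (x : ℝ) : ℂ := (2 : ℂ) ^ n * φ (2 ^ n * x)

/-- The frequency cutoff of a tempered distribution. -/
def lowPass (φ : 𝓢(ℝ, ℂ)) (n : ℕ) (u : 𝓢'(ℝ, E)) : 𝓢'(ℝ, E) :=
  TemperedDistribution.fourierMultiplierCLM E (cutoff φ n) u

section Cutoff

variable (φ : 𝓢(ℝ, ℂ))

theorem cutoff_hasTemperateGrowth (n : ℕ) : (cutoff φ n).HasTemperateGrowth :=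
  (𝓕 φ).hasTemperateGrowth.comp (g := ⇑(𝓕 φ : 𝓢(ℝ, ℂ))) (f := fun ξ : ℝ => (2 ^ n)⁻¹ * ξ) (by fun_prop)

theorem symbol_zero : symbol φ 0 = cutoff φ 0 := by
  ext ξ
  simp [symbol, cutoff]

theorem symbol_succ (k : ℕ) : symbol φ (k + 1) = cutoff φ (k + 1) - cutoff φ k := by
  ext ξ
  simp only [symbol, cutoff, Pi.sub_apply]
  congr 2
  rw [pow_succ]
  field_simp

theorem symbol_hasTemperateGrowth (k : ℕ) : (symbol φ k).HasTemperateGrowth := by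
  rcases k with _ | k
  · rw [symbol_zero]
    exact cutoff_hasTemperateGrowth φ 0
  · rw [symbol_succ]
    exact (cutoff_hasTemperateGrowth φ _).sub (cutoff_hasTemperateGrowth φ _)

theorem piece_zero (u : 𝓢'(ℝ, E)) : piece φ 0 u = lowPass φ 0 u := by
  rw [piece, lowPass, symbol_zero]

theorem piece_succ (k : ℕ) (u : 𝓢'(ℝ, E)) :
    piece φ (k + 1) u = lowPass φ (k + 1) u - lowPass φ k u := by
  rw [piece, lowPass, lowPass, symbol_succ]
  simp only [TemperedDistribution.fourierMultiplierCLM_apply]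
  rw [TemperedDistribution.smulLeftCLM_sub (cutoff_hasTemperateGrowth φ _)
    (cutoff_hasTemperateGrowth φ _)]
  simp [sub_eq_add_neg, FourierTransform.fourierInv_add, FourierTransform.fourierInv_neg]

theorem sum_piece (n : ℕ) (u : 𝓢'(ℝ, E)) :
    ∑ k ∈ Finset.range (n + 1), piece φ k u = lowPass φ n u := by
  induction n with
  | zero => simp [piece_zero]
  | succ n ih => rw [Finset.sum_range_succ, ih, piece_succ, add_sub_cancel]

variable {φ}

theorem cutoff_eq_one (hφ : IsGenerator φ) {n : ℕ} {ξ : ℝ} (h : |ξ| ≤ 2 ^ n) :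
    cutoff φ n ξ = 1 := by
  refine hφ.eq_one _ ?_
  rw [abs_mul, abs_of_pos (by positivity)]
  exact (inv_mul_le_one₀ (by positivity)).2 h

theorem cutoff_eq_zero (hφ : IsGenerator φ) {n : ℕ} {ξ : ℝ} (h : 2 ^ (n + 1) ≤ |ξ|) :
    cutoff φ n ξ = 0 := by
  refine hφ.eq_zero _ ?_
  rw [abs_mul, abs_of_pos (by positivity), inv_mul_eq_div, le_div_iff₀ (by positivity)]
  refine le_trans ?_ h
  rw [pow_succ, mul_comm]
  gcongr
  norm_num

theorem symbol_mul_cutoff (hφ : IsGenerator φ) (k : ℕ) :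
    symbol φ k * cutoff φ (k + 1) = symbol φ k := by
  ext ξ
  rw [Pi.mul_apply]
  rcases le_total |ξ| (2 ^ (k + 1)) with h | h
  · rw [cutoff_eq_one hφ h, mul_one]
  · have : symbol φ k ξ = 0 := by
      rcases k with _ | k
      · rw [symbol_zero, cutoff_eq_zero hφ h]
      · rw [symbol_succ, Pi.sub_apply, cutoff_eq_zero hφ h, cutoff_eq_zero hφ, sub_zero]
        exact le_trans (pow_le_pow_right₀ one_le_two (by omega)) h
    rw [this, zero_mul]

/-- The `k`-th symbol lives where the cutoff at level `k + 1` equals one. Hence any `L^r`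
representative of a piece may be replaced by its smooth convolution with the kernel at level `k +
1`. -/
theorem lowPass_piece (hφ : IsGenerator φ) (k : ℕ) (u : 𝓢'(ℝ, E)) :
    lowPass φ (k + 1) (piece φ k u) = piece φ k u := by
  rw [lowPass, piece, TemperedDistribution.fourierMultiplierCLM_fourierMultiplierCLM_apply
    (symbol_hasTemperateGrowth φ k) (cutoff_hasTemperateGrowth φ _), symbol_mul_cutoff hφ]

/-- The weight `1 + |x|` buys the decay `2^{-n}` uniformly in `x`: at order zero the difference
vanishes for `|x| ≤ 2^n`, and beyond that `2^{-n} |x| ≥ 1`. Each derivative gains a factor `2^{-n}`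
by scaling. -/
theorem norm_iteratedFDeriv_cutoff_sub_one_le (hφ : IsGenerator φ) (i : ℕ) :
    ∃ B : ℝ, 0 ≤ B ∧ ∀ (n : ℕ) (x : ℝ),
      ‖iteratedFDeriv ℝ i (fun ξ => cutoff φ n ξ - 1) x‖ ≤ (2 ^ n)⁻¹ * B * (1 + |x|) := by
  set C := SchwartzMap.seminorm ℝ 0 i (𝓕 φ) with hC
  have hC0 : 0 ≤ C := apply_nonneg _ _
  refine ⟨C + 1, by positivity, fun n x => ?_⟩
  have hn : (0 : ℝ) < (2 ^ n)⁻¹ := by positivity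
  rcases i with _ | i
  · rw [norm_iteratedFDeriv_zero]
    rcases le_total |x| (2 ^ n) with h | h
    · rw [cutoff_eq_one hφ h, sub_self, norm_zero]
      positivity
    · have h1 : ‖cutoff φ n x - 1‖ ≤ C + 1 := by
        refine (norm_sub_le _ _).trans ?_
        rw [norm_one]
        gcongr
        exact (𝓕 φ).norm_le_seminorm ℝ _
      have h2 : 1 ≤ (2 ^ n)⁻¹ * (1 + |x|) := by
        rw [inv_mul_eq_div, le_div_iff₀ (by positivity)]
        linarith
      calc ‖cutoff φ n x - 1‖ ≤ (C + 1) * 1 := by rwa [mul_one]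
        _ ≤ (C + 1) * ((2 ^ n)⁻¹ * (1 + |x|)) := by gcongr
        _ = _ := by ring
  · have h1 : iteratedDeriv (i + 1) (fun ξ => cutoff φ n ξ - 1) =
        iteratedDeriv (i + 1) (cutoff φ n) := by
      ext y
      rw [iteratedDeriv_succ', iteratedDeriv_succ']
      congr 1
      ext z
      exact deriv_sub_const _
    have h2 : iteratedDeriv (i + 1) (cutoff φ n) x =
        ((2 ^ n : ℝ)⁻¹) ^ (i + 1) • iteratedDeriv (i + 1) (⇑(𝓕 φ : 𝓢(ℝ, ℂ))) ((2 ^ n)⁻¹ * x) := by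
      have := iteratedDeriv_comp_const_smul (n := i + 1) (f := ⇑(𝓕 φ : 𝓢(ℝ, ℂ)))
        (by exact_mod_cast (𝓕 φ).smooth (i + 1 : ℕ)) ((2 ^ n : ℝ)⁻¹)
      exact congrFun this x
    rw [norm_iteratedFDeriv_eq_norm_iteratedDeriv, h1, h2, norm_smul, norm_pow, Real.norm_eq_abs,
      abs_of_pos hn]
    have h3 : ‖iteratedDeriv (i + 1) (⇑(𝓕 φ : 𝓢(ℝ, ℂ))) ((2 ^ n)⁻¹ * x)‖ ≤ C := by
      rw [← norm_iteratedFDeriv_eq_norm_iteratedDeriv]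
      exact (𝓕 φ).norm_iteratedFDeriv_le_seminorm ℝ _ _
    have h4 : ((2 ^ n : ℝ)⁻¹) ^ (i + 1) ≤ (2 ^ n)⁻¹ :=
      pow_le_of_le_one hn.le (inv_le_one_of_one_le₀ (one_le_pow₀ one_le_two)) (by omega)
    calc ((2 ^ n : ℝ)⁻¹) ^ (i + 1) * ‖iteratedDeriv (i + 1) (⇑(𝓕 φ : 𝓢(ℝ, ℂ))) ((2 ^ n)⁻¹ * x)‖
        ≤ (2 ^ n)⁻¹ * (C + 1) := by gcongr; linarith
      _ ≤ (2 ^ n)⁻¹ * (C + 1) * (1 + |x|) :=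
        le_mul_of_one_le_right (by positivity) (by linarith [abs_nonneg x])

/-- Frequency cutoffs converge to the identity in the Schwartz space. -/
theorem tendsto_cutoff_smul (hφ : IsGenerator φ) (h : 𝓢(ℝ, ℂ)) :
    Tendsto (fun n => SchwartzMap.smulLeftCLM ℂ (cutoff φ n) h) atTop (𝓝 h) := by
  rw [(schwartz_withSeminorms ℝ ℝ ℂ).tendsto_nhds]
  rintro ⟨k, m⟩ ε hε
  choose B hB0 hB using norm_iteratedFDeriv_cutoff_sub_one_le hφ
  set M := ∑ i ∈ Finset.range (m + 1), (m.choose i : ℝ) * B i *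
    (SchwartzMap.seminorm ℝ k (m - i) h + SchwartzMap.seminorm ℝ (k + 1) (m - i) h) with hM
  have hM0 : 0 ≤ M := Finset.sum_nonneg fun i _ =>
    mul_nonneg (mul_nonneg (by positivity) (hB0 i)) (add_nonneg (apply_nonneg _ _)
      (apply_nonneg _ _))
  have bound : ∀ n, SchwartzMap.seminorm ℝ k m (SchwartzMap.smulLeftCLM ℂ (cutoff φ n) h - h) ≤
      (2 ^ n)⁻¹ * M := by
    intro n
    refine SchwartzMap.seminorm_le_bound ℝ k m _ (by positivity) fun x => ?_
    have e : ⇑(SchwartzMap.smulLeftCLM ℂ (cutoff φ n) h - h) =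
        fun ξ => (cutoff φ n ξ - 1) * h ξ := by
      ext ξ
      rw [_root_.sub_apply, SchwartzMap.smulLeftCLM_apply_apply (cutoff_hasTemperateGrowth φ n),
        smul_eq_mul, sub_mul, one_mul]
    have hc : ContDiff ℝ (⊤ : ℕ∞) fun ξ => cutoff φ n ξ - 1 :=
      (cutoff_hasTemperateGrowth φ n).1.sub contDiff_const
    rw [e]
    calc ‖x‖ ^ k * ‖iteratedFDeriv ℝ m (fun ξ => (cutoff φ n ξ - 1) * h ξ) x‖
        ≤ ‖x‖ ^ k * ∑ i ∈ Finset.range (m + 1), (m.choose i : ℝ) *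
          ‖iteratedFDeriv ℝ i (fun ξ => cutoff φ n ξ - 1) x‖ * ‖iteratedFDeriv ℝ (m - i) h x‖ := by
          gcongr
          exact norm_iteratedFDeriv_mul_le hc (h.smooth ⊤) x (by exact_mod_cast le_top)
      _ ≤ ‖x‖ ^ k * ∑ i ∈ Finset.range (m + 1), (m.choose i : ℝ) *
          ((2 ^ n)⁻¹ * B i * (1 + |x|)) * ‖iteratedFDeriv ℝ (m - i) h x‖ := by
          gcongr with i
          exact hB i n x
      _ = (2 ^ n)⁻¹ * ∑ i ∈ Finset.range (m + 1), (m.choose i : ℝ) * B i *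
          (‖x‖ ^ k * ‖iteratedFDeriv ℝ (m - i) h x‖ +
            ‖x‖ ^ (k + 1) * ‖iteratedFDeriv ℝ (m - i) h x‖) := by
          rw [Finset.mul_sum, Finset.mul_sum]
          refine Finset.sum_congr rfl fun i _ => ?_
          rw [← Real.norm_eq_abs]
          ring
      _ ≤ (2 ^ n)⁻¹ * M := by
          rw [hM]
          gcongr with i
          · exact mul_nonneg (by positivity) (hB0 i)
          · exact h.le_seminorm ℝ k (m - i) x
          · exact h.le_seminorm ℝ (k + 1) (m - i) x
  have lim : Tendsto (fun n : ℕ => ((2 : ℝ) ^ n)⁻¹ * M) atTop (𝓝 0) := by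
    have := (tendsto_inv_atTop_zero.comp
      (tendsto_pow_atTop_atTop_of_one_lt (one_lt_two (α := ℝ)))).mul_const M
    rwa [zero_mul] at this
  filter_upwards [lim.eventually (gt_mem_nhds hε)] with n hn
  exact (bound n).trans_lt hn

theorem tendsto_lowPass (hφ : IsGenerator φ) (u : 𝓢'(ℝ, E)) (g : 𝓢(ℝ, ℂ)) :
    Tendsto (fun n => lowPass φ n u g) atTop (𝓝 (u g)) := by
  have h1 := tendsto_cutoff_smul hφ (𝓕⁻ g)
  have h2 : Continuous fun h : 𝓢(ℝ, ℂ) => u (𝓕 h) :=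
    u.continuous.comp (FourierTransform.fourierCLM ℂ 𝓢(ℝ, ℂ)).continuous
  have h3 := (h2.tendsto (𝓕⁻ g)).comp h1
  rwa [FourierTransform.fourier_fourierInv_eq] at h3

theorem hasSum_piece (hφ : IsGenerator φ) (u : 𝓢'(ℝ, E)) (g : 𝓢(ℝ, ℂ))
    (hs : Summable fun k => piece φ k u g) : HasSum (fun k => piece φ k u g) (u g) := by
  refine hs.hasSum_iff_tendsto_nat.2 ((tendsto_add_atTop_iff_nat 1).1 ?_)
  refine (tendsto_lowPass hφ u g).congr fun n => ?_
  rw [← sum_piece]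
  simp

/-! ### The kernel of a frequency cutoff -/

variable (φ)

theorem integrable_cutoff (n : ℕ) : Integrable (cutoff φ n) :=
  (𝓕 φ).integrable.comp_mul_left' (by positivity)

theorem fourierInv_cutoff (n : ℕ) (x : ℝ) : 𝓕⁻ (cutoff φ n) x = kernel φ n x := by
  have h2 : (2 : ℝ) ^ n ≠ 0 := by positivity
  have key : 𝓕⁻ (cutoff φ n) x = |(2 : ℝ) ^ n| • 𝓕⁻ (⇑(𝓕 φ : 𝓢(ℝ, ℂ))) (2 ^ n * x) := by
    rw [Real.fourierInv_eq', Real.fourierInv_eq']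
    have := Measure.integral_comp_mul_left (fun η : ℝ =>
      Complex.exp ((↑(2 * Real.pi * inner ℝ η (2 ^ n * x)) * Complex.I)) • (𝓕 φ : 𝓢(ℝ, ℂ)) η) ((2 ^ n : ℝ)⁻¹)
    rw [inv_inv] at this
    rw [← this]
    refine integral_congr_ae (Eventually.of_forall fun ξ => ?_)
    simp only [cutoff, RCLike.inner_apply, conj_trivial]
    congr 5
    field_simp
  rw [key, ← SchwartzMap.fourierInv_coe, FourierTransform.fourierInv_fourier_eq, kernel,
    abs_of_pos (by positivity), Complex.real_smul]
  push_cast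
  rfl

/-- A multiplier acts on distributions by transposition, and this computes the transposed operator
on test functions. It is the multiplication formula that moves the Fourier transform from `g(-·)` to
the cutoff modulated by the frequency character at `x`; the result is integration against the
reflected kernel. -/
theorem fourier_cutoff_smul_fourierInv (n : ℕ) (g : 𝓢(ℝ, ℂ)) (x : ℝ) :
    𝓕 (SchwartzMap.smulLeftCLM ℂ (cutoff φ n) (𝓕⁻ g)) x = ∫ y, kernel φ n (y - x) * g y := by
  let h : ℝ → ℂ := fun ξ => Complex.exp ((↑(-2 * Real.pi * (ξ * x)) * Complex.I)) * cutoff φ n ξ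
  have hh : Integrable h := by
    refine (integrable_cutoff φ n).bdd_mul (c := 1)
      (Continuous.aestronglyMeasurable (by fun_prop)) (Eventually.of_forall fun ξ => ?_)
    rw [Complex.norm_exp_ofReal_mul_I]
  have hFh : ∀ y, 𝓕 h y = kernel φ n (-y - x) := by
    intro y
    rw [← fourierInv_cutoff, Real.fourierInv_eq', Real.fourier_eq']
    refine integral_congr_ae (Eventually.of_forall fun ξ => ?_)
    simp only [h, RCLike.inner_apply, conj_trivial, smul_eq_mul]
    rw [← mul_assoc, ← Complex.exp_add]
    congr 2
    push_cast
    ring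
  have hflip : ∫ ξ, 𝓕 (fun y => g (-y)) ξ • h ξ = ∫ y, g (-y) • 𝓕 h y := by
    simpa using! VectorFourier.integral_fourierIntegral_smul_eq_flip (L := innerₗ ℝ)
      Real.continuous_fourierChar continuous_inner g.integrable.comp_neg hh
  calc 𝓕 (SchwartzMap.smulLeftCLM ℂ (cutoff φ n) (𝓕⁻ g)) x
      = ∫ ξ, 𝓕 (fun y => g (-y)) ξ • h ξ := by
        rw [SchwartzMap.fourier_coe, Real.fourier_eq']
        refine integral_congr_ae (Eventually.of_forall fun ξ => ?_)
        simp only [h]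
        rw [SchwartzMap.smulLeftCLM_apply_apply (cutoff_hasTemperateGrowth φ n),
          SchwartzMap.fourierInv_coe, Real.fourierInv_eq_fourier_comp_neg]
        simp only [RCLike.inner_apply, conj_trivial, smul_eq_mul]
        rw [mul_comm x ξ]
        ring
    _ = ∫ y, g (-y) • kernel φ n (-y - x) := by rw [hflip]; simp only [hFh]
    _ = ∫ y, g y • kernel φ n (y - x) :=
        integral_neg_eq_self (fun y => g y • kernel φ n (y - x)) volume
    _ = _ := by simp only [smul_eq_mul, mul_comm]

theorem lintegral_comp_two_pow_mul (g : ℝ → ℝ≥0∞) (n : ℕ) :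
    2 ^ n * ∫⁻ x, g (2 ^ n * x) = ∫⁻ x, g x := by
  have h2 : (2 : ℝ) ^ n ≠ 0 := by positivity
  have hmap := Real.smul_map_volume_mul_left h2
  have e : ENNReal.ofReal |(2 : ℝ) ^ n| = 2 ^ n := by
    rw [abs_of_pos (by positivity), ENNReal.ofReal_pow (by norm_num), ENNReal.ofReal_ofNat]
  nth_rw 2 [← hmap]
  rw [lintegral_smul_measure, e, smul_eq_mul,
    (measurableEmbedding_mulLeft₀ h2).lintegral_map]

theorem enorm_kernel (n : ℕ) (x : ℝ) : ‖kernel φ n x‖ₑ = 2 ^ n * ‖φ (2 ^ n * x)‖ₑ := by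
  rw [kernel, enorm_mul, enorm_pow]
  congr 2
  rw [← ofReal_norm]
  simp

theorem lintegral_enorm_kernel (n : ℕ) : ∫⁻ x, ‖kernel φ n x‖ₑ = ∫⁻ x, ‖φ x‖ₑ := by
  simp only [enorm_kernel]
  rw [lintegral_const_mul' _ _ (by simp), lintegral_comp_two_pow_mul fun x => ‖φ x‖ₑ]

/-- The first moment of the kernel scales like `2^{-n}`; this is the source of the smoothness `1/r`
of functions in `V^r`. -/
theorem lintegral_enorm_kernel_mul_abs (n : ℕ) :
    2 ^ n * ∫⁻ x, ‖kernel φ n x‖ₑ * ENNReal.ofReal |x| =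
      ∫⁻ x, ‖φ x‖ₑ * ENNReal.ofReal |x| := by
  rw [← lintegral_comp_two_pow_mul (fun x => ‖φ x‖ₑ * ENNReal.ofReal |x|) n]
  congr 1
  refine lintegral_congr fun x => ?_
  rw [enorm_kernel, abs_mul, ENNReal.ofReal_mul (abs_nonneg _),
    abs_of_pos (by positivity : (0 : ℝ) < 2 ^ n),
    ENNReal.ofReal_pow (by norm_num), ENNReal.ofReal_ofNat]
  ring

theorem isKernel_kernel (n : ℕ) : IsKernel (kernel φ n) where
  continuous := continuous_const.mul (φ.continuous.comp (by fun_prop))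
  lintegral_ne_top := by
    rw [lintegral_enorm_kernel]
    exact (isKernel_schwartzMap φ).lintegral_ne_top
  bounded := by
    obtain ⟨B, hB, hφB⟩ := (isKernel_schwartzMap φ).bounded
    refine ⟨2 ^ n * B, ENNReal.mul_ne_top (by simp) hB, fun x => ?_⟩
    rw [enorm_kernel]
    gcongr
    exact hφB _

theorem hasDerivAt_kernel (n : ℕ) (x : ℝ) :
    HasDerivAt (kernel φ n) (2 ^ n * kernel (SchwartzMap.derivCLM ℂ ℂ φ) n x) x := by
  have h1 : HasDerivAt (fun y : ℝ => (2 : ℝ) ^ n * y) (2 ^ n) x := by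
    simpa using (hasDerivAt_id x).const_mul ((2 : ℝ) ^ n)
  have h2 := (φ.differentiableAt (x := 2 ^ n * x)).hasDerivAt.scomp x h1
  have h3 := h2.const_mul ((2 : ℂ) ^ n)
  refine HasDerivAt.congr_deriv (f := kernel φ n) h3 ?_
  simp only [kernel, SchwartzMap.derivCLM_apply, Complex.real_smul]
  push_cast
  ring

theorem integral_kernel (hφ : IsGenerator φ) (n : ℕ) : ∫ x, kernel φ n x = 1 := by
  have h1 : ∫ x, φ x = 1 := by
    rw [← hφ.eq_one 0 (by simp), SchwartzMap.fourier_coe, Real.fourier_eq']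
    simp
  have h2 := Measure.integral_comp_mul_left φ ((2 : ℝ) ^ n)
  simp only [kernel]
  rw [integral_const_mul, h2, h1, abs_of_pos (by positivity), Complex.real_smul]
  push_cast
  rw [mul_one, mul_inv_cancel₀ (pow_ne_zero _ two_ne_zero)]

/-- Frequency cutoffs act on functions by convolution. -/
theorem Represents.lowPass [CompleteSpace E] {r : ℝ} (hr : 1 ≤ r) {f : ℝ → E} {u : 𝓢'(ℝ, E)}
    (h : Represents (ENNReal.ofReal r) f u) (n : ℕ) :
    Represents (ENNReal.ofReal r) (conv (kernel φ n) f) (lowPass φ n u) := by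
  refine ⟨(isKernel_kernel φ n).memLp_conv hr h.1, fun g => ?_⟩
  rw [(isKernel_kernel φ n).integral_smul_conv hr h.1, BesovVariation.lowPass,
    TemperedDistribution.fourierMultiplierCLM_apply_apply, h.2]
  simp only [fourier_cutoff_smul_fourierInv]

end Cutoff

/-! ### Embeddings -/

theorem Represents.sub {r : ℝ} (hr : 1 ≤ r) {f g : ℝ → E} {u v : 𝓢'(ℝ, E)}
    (hf : Represents (ENNReal.ofReal r) f u) (hg : Represents (ENNReal.ofReal r) g v) :
    Represents (ENNReal.ofReal r) (fun x => f x - g x) (u - v) := by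
  refine ⟨hf.1.sub hg.1, fun h => ?_⟩
  have e : (u - v) h = u h - v h := rfl
  rw [e, hf.2, hg.2, ← integral_sub ((isKernel_schwartzMap h).integrable_smul hr hf.1)
    ((isKernel_schwartzMap h).integrable_smul hr hg.1)]
  simp only [smul_sub]

theorem lpENorm_le {p : ℝ≥0∞} {f : ℝ → E} {u : 𝓢'(ℝ, E)} (h : Represents p f u) :
    lpENorm p u ≤ eLpNorm f p volume := iInf₂_le f h

theorem interLpENorm_le {p : ℝ≥0∞} {N : (ℝ → E) → ℝ≥0∞} {f : ℝ → E} {u : 𝓢'(ℝ, E)}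
    (h : Represents p f u) : interLpENorm p N u ≤ N f + eLpNorm f p volume := iInf₂_le f h

/-- The constant has to be nonzero and finite to commute with the infimum, which is `∞` if there is
no representative. -/
theorem le_mul_interLpENorm {p c X : ℝ≥0∞} (hc0 : c ≠ 0) (hc : c ≠ ∞) {N : (ℝ → E) → ℝ≥0∞}
    {u : 𝓢'(ℝ, E)} (h : ∀ f, Represents p f u → X ≤ c * (N f + eLpNorm f p volume)) :
    X ≤ c * interLpENorm p N u := by
  rw [interLpENorm, ENNReal.mul_iInf_of_ne hc0 hc]
  refine le_iInf fun f => ?_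
  rw [ENNReal.mul_iInf_of_ne hc0 hc]
  exact le_iInf fun hf => h f hf

/-! #### From `R^r` to `V^r` -/

theorem vENorm_add_eLpNorm_le {r : ℝ} (hr : 1 ≤ r) (p : ℝ≥0∞) (f : ℝ → E) :
    vENorm r f + eLpNorm f p volume ≤ 3 * (rENorm r f + eLpNorm f p volume) := by
  rw [mul_add]
  exact add_le_add (vENorm_le_rENorm hr f) (le_mul_of_one_le_left zero_le (by norm_num))

theorem embeds_rENorm_vENorm {r : ℝ} (hr : 1 ≤ r) (p : ℝ≥0∞) :
    Embeds (E := E) (interLpENorm p (rENorm r)) (interLpENorm p (vENorm r)) :=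
  ⟨3, fun _ _ => le_mul_interLpENorm (by simp) (by simp) fun f hf =>
    (interLpENorm_le hf).trans (vENorm_add_eLpNorm_le hr p f)⟩

/-! #### From `V^r` to Besov spaces -/

/-- The weight `2 ^ (k / r)` in the Besov norm of smoothness `1 / r`. -/
def weight (r : ℝ) (k : ℕ) : ℝ≥0∞ := ENNReal.ofReal ((2 : ℝ) ^ ((k : ℝ) * (1 / r)))

theorem weight_rpow {r : ℝ} (hr : 0 < r) (k : ℕ) : weight r k ^ r = 2 ^ k := by
  rw [weight, ENNReal.ofReal_rpow_of_nonneg (by positivity) hr.le, ← Real.rpow_mul (by norm_num),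
    mul_assoc, one_div_mul_cancel hr.ne', mul_one, Real.rpow_natCast,
    ENNReal.ofReal_pow (by norm_num), ENNReal.ofReal_ofNat]

theorem weight_zero (r : ℝ) : weight r 0 = 1 := by simp [weight]

theorem one_le_weight {r : ℝ} (hr : 0 < r) (k : ℕ) : 1 ≤ weight r k := by
  rw [← ENNReal.rpow_le_rpow_iff hr, weight_rpow hr, ENNReal.one_rpow]
  exact one_le_pow₀ (by norm_num)

theorem weight_succ_le {r : ℝ} (hr : 1 ≤ r) (k : ℕ) : weight r (k + 1) ≤ 2 * weight r k := by
  have hr0 : 0 < r := by linarith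
  rw [← ENNReal.rpow_le_rpow_iff hr0, ENNReal.mul_rpow_of_nonneg _ _ hr0.le, weight_rpow hr0,
    weight_rpow hr0, pow_succ, mul_comm]
  gcongr
  calc (2 : ℝ≥0∞) = 2 ^ (1 : ℝ) := (ENNReal.rpow_one 2).symm
    _ ≤ 2 ^ r := ENNReal.rpow_le_rpow_of_exponent_le (by norm_num) hr

section Kernel

variable (φ : 𝓢(ℝ, ℂ)) {r : ℝ} {f : ℝ → E}

theorem lintegral_enorm_mul_abs_ne_top : ∫⁻ x, ‖φ x‖ₑ * ENNReal.ofReal |x| ≠ ∞ := by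
  have := (φ.integrable_pow_mul volume 1).hasFiniteIntegral.ne
  refine ne_of_eq_of_ne (lintegral_congr fun x => ?_) this
  simp only [pow_one]
  rw [enorm_mul, enorm_norm, enorm_norm, mul_comm, ← Real.norm_eq_abs, ofReal_norm]

variable {φ}

/-- Since the kernel has integral one, the error of the approximation is the average of the
increments `f (x - y) - f x` against the kernel. -/
theorem enorm_conv_kernel_sub_le [CompleteSpace E] (hφ : IsGenerator φ) (hr : 1 ≤ r)
    (hf : MemLp f (ENNReal.ofReal r)) (n : ℕ) (x : ℝ) :
    ‖conv (kernel φ n) f x - f x‖ₑ ≤ ∫⁻ y, ‖kernel φ n y‖ₑ * ‖f (x - y) - f x‖ₑ := by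
  have hK := isKernel_kernel φ n
  have hKi : Integrable (kernel φ n) :=
    ⟨hK.continuous.aestronglyMeasurable, hK.lintegral_ne_top.lt_top⟩
  have e1 : conv (kernel φ n) f x = ∫ y, kernel φ n y • f (x - y) := by
    rw [conv, ← integral_sub_left_eq_self (fun y => kernel φ n y • f (x - y)) volume x]
    simp only [sub_sub_cancel]
  have hi : Integrable fun y => kernel φ n y • f (x - y) := by
    have := (hK.integrable_conv hr hf x).comp_sub_left x
    simpa only [sub_sub_cancel] using this
  have e2 : f x = ∫ y, kernel φ n y • f x := by
    rw [integral_smul_const, integral_kernel φ hφ, one_smul]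
  have e3 : conv (kernel φ n) f x - f x = ∫ y, kernel φ n y • (f (x - y) - f x) := by
    conv_lhs => rw [e1, e2]
    rw [← integral_sub hi (hKi.smul_const _)]
    simp only [smul_sub]
  rw [e3]
  refine (enorm_integral_le_lintegral_enorm _).trans_eq ?_
  simp only [enorm_smul]

/-- After raising to the power `r`, the weight is `2^n` and cancels the decay `2^{-n}` of the first
moment, so the constant does not depend on `n`. -/
theorem weight_mul_eLpNorm_conv_kernel_sub_le [CompleteSpace E] (hφ : IsGenerator φ) (hr : 1 ≤ r)
    (hf : MemLp f (ENNReal.ofReal r)) (n : ℕ) :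
    weight r n * eLpNorm (fun x => conv (kernel φ n) f x - f x) (ENNReal.ofReal r) volume ≤
      ((∫⁻ x, ‖φ x‖ₑ) ^ (r - 1) * ∫⁻ x, ‖φ x‖ₑ * ENNReal.ofReal |x|) ^ (1 / r) *
        variationSeminorm r f := by
  have hr0 : 0 < r := by linarith
  rw [← ENNReal.rpow_le_rpow_iff hr0, ENNReal.mul_rpow_of_nonneg _ _ hr0.le,
    ENNReal.mul_rpow_of_nonneg _ _ hr0.le, weight_rpow hr0, eLpNorm_ofReal_rpow hr0,
    ← ENNReal.rpow_mul, one_div_mul_cancel hr0.ne', ENNReal.rpow_one]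
  calc 2 ^ n * ∫⁻ x, ‖conv (kernel φ n) f x - f x‖ₑ ^ r
      ≤ 2 ^ n * ∫⁻ x, (∫⁻ y, ‖kernel φ n y‖ₑ * ‖f (x - y) - f x‖ₑ) ^ r := by
        gcongr with x
        exact enorm_conv_kernel_sub_le hφ hr hf n x
    _ ≤ 2 ^ n * ((∫⁻ y, ‖kernel φ n y‖ₑ) ^ (r - 1) *
        (∫⁻ y, ‖kernel φ n y‖ₑ * ENNReal.ofReal |y|) * variationSeminorm r f ^ r) := by
        gcongr
        exact lintegral_convolution_translate_sub_rpow_le hr hf.1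
          (isKernel_kernel φ n).continuous.enorm.measurable
    _ = _ := by
        rw [← lintegral_enorm_kernel_mul_abs φ n, lintegral_enorm_kernel]
        ring

theorem embeds_vENorm_besovENorm [CompleteSpace E] (hφ : IsGenerator φ) (hr : 1 ≤ r) :
    Embeds (E := E) (interLpENorm (ENNReal.ofReal r) (vENorm r))
      (besovENorm φ (1 / r) (ENNReal.ofReal r) ∞) := by
  have hr0 : 0 < r := by linarith
  set I := ∫⁻ x, ‖φ x‖ₑ with hI
  set c := (I ^ (r - 1) * ∫⁻ x, ‖φ x‖ₑ * ENNReal.ofReal |x|) ^ (1 / r) with hc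
  have hItop : I ≠ ∞ := (isKernel_schwartzMap φ).lintegral_ne_top
  have hctop : c ≠ ∞ := ENNReal.rpow_ne_top_of_nonneg (by positivity) (ENNReal.mul_ne_top
    (ENNReal.rpow_ne_top_of_nonneg (by linarith) hItop) (lintegral_enorm_mul_abs_ne_top φ))
  -- The `1` keeps `C` nonzero and `I` serves the lowest piece. For the other pieces, `3 * c` is `c`
  -- from the error at level `k + 1` plus `2 * c` from level `k`, as consecutive weights differ at
  -- most by the factor `2`.
  set C : ℝ≥0∞ := 1 + I + 3 * c with hC
  have hCtop : C ≠ ∞ := by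
    simp only [hC, Ne, ENNReal.add_eq_top, not_or]
    exact ⟨⟨by simp, hItop⟩, ENNReal.mul_ne_top (by simp) hctop⟩
  refine ⟨C.toNNReal, fun u _ => ?_⟩
  rw [ENNReal.coe_toNNReal hCtop]
  refine le_mul_interLpENorm (by simp [hC]) hCtop fun f hf => ?_
  rw [besovENorm, seqENorm, if_pos rfl]
  refine iSup_le fun k => ?_
  change weight r k * _ ≤ _
  rcases k with _ | k
  · rw [weight_zero, one_mul, piece_zero]
    calc lpENorm (ENNReal.ofReal r) (lowPass φ 0 u)
        ≤ I * eLpNorm f (ENNReal.ofReal r) volume := by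
          refine (lpENorm_le (hf.lowPass φ hr 0)).trans ?_
          rw [hI, ← lintegral_enorm_kernel φ 0]
          exact eLpNorm_conv_le (isKernel_kernel φ 0).continuous hr hf.1.1
      _ ≤ C * (vENorm r f + eLpNorm f (ENNReal.ofReal r) volume) := by
          gcongr
          · exact le_add_self.trans le_self_add
          · exact le_add_self
  · have hrep := (hf.lowPass φ hr (k + 1)).sub hr (hf.lowPass φ hr k)
    rw [← piece_succ] at hrep
    have hm : ∀ n, AEStronglyMeasurable fun x => conv (kernel φ n) f x - f x := fun n =>
      (aestronglyMeasurable_conv (isKernel_kernel φ n).continuous hf.1.1).sub hf.1.1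
    have htri : eLpNorm (fun x => conv (kernel φ (k + 1)) f x - conv (kernel φ k) f x)
        (ENNReal.ofReal r) volume ≤
        eLpNorm (fun x => conv (kernel φ (k + 1)) f x - f x) (ENNReal.ofReal r) volume +
        eLpNorm (fun x => conv (kernel φ k) f x - f x) (ENNReal.ofReal r) volume := by
      have e : (fun x => conv (kernel φ (k + 1)) f x - conv (kernel φ k) f x) =
          (fun x => conv (kernel φ (k + 1)) f x - f x) - fun x => conv (kernel φ k) f x - f x := by
        ext x
        simp
      rw [e]
      exact eLpNorm_sub_le (hm _) (hm _) (by simpa using hr)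
    calc weight r (k + 1) * lpENorm (ENNReal.ofReal r) (piece φ (k + 1) u)
        ≤ weight r (k + 1) *
          (eLpNorm (fun x => conv (kernel φ (k + 1)) f x - f x) (ENNReal.ofReal r) volume +
          eLpNorm (fun x => conv (kernel φ k) f x - f x) (ENNReal.ofReal r) volume) := by
          gcongr
          exact (lpENorm_le hrep).trans htri
      _ ≤ weight r (k + 1) *
          eLpNorm (fun x => conv (kernel φ (k + 1)) f x - f x) (ENNReal.ofReal r) volume +
          2 * (weight r k *
            eLpNorm (fun x => conv (kernel φ k) f x - f x) (ENNReal.ofReal r) volume) := by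
          rw [mul_add, ← mul_assoc 2]
          gcongr
          exact weight_succ_le hr k
      _ ≤ c * variationSeminorm r f + 2 * (c * variationSeminorm r f) := by
          refine add_le_add (weight_mul_eLpNorm_conv_kernel_sub_le hφ hr hf.1 (k + 1)) ?_
          exact mul_le_mul_right (weight_mul_eLpNorm_conv_kernel_sub_le hφ hr hf.1 k) _
      _ = 3 * c * variationSeminorm r f := by ring
      _ ≤ C * (vENorm r f + eLpNorm f (ENNReal.ofReal r) volume) := by
          gcongr
          · exact le_add_self
          · exact le_add_self.trans le_self_add

/-! #### From Besov spaces to `R^r` and `V^1` -/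

/-- Reconstruction of a distribution from functions representing its Littlewood-Paley pieces. -/
theorem represents_of_hasSum [CompleteSpace E] (hφ : IsGenerator φ) (hr : 1 ≤ r)
    {u : 𝓢'(ℝ, E)} {F : ℕ → ℝ → E}
    (hF : ∀ k, Represents (ENNReal.ofReal r) (F k) (piece φ k u)) {N : ℕ → ℝ≥0∞}
    (hFN : ∀ k x, ‖F k x‖ₑ ≤ N k) (hN : ∑' k, N k ≠ ∞)
    (hs : ∀ x, HasSum (fun k => F k x) (f x))
    (he : ∑' k, eLpNorm (F k) (ENNReal.ofReal r) volume ≠ ∞) :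
    Represents (ENNReal.ofReal r) f u ∧ eLpNorm f (ENNReal.ofReal r) volume ≤
      ∑' k, eLpNorm (F k) (ENNReal.ofReal r) volume := by
  have hmeas : ∀ n, AEStronglyMeasurable (∑ k ∈ Finset.range n, F k) := fun n =>
    Finset.aestronglyMeasurable_sum _ fun k _ => (hF k).1.1
  have hlim : ∀ᵐ x, Tendsto (fun n => (∑ k ∈ Finset.range n, F k) x) atTop (𝓝 (f x)) :=
    Eventually.of_forall fun x => by simpa using (hs x).tendsto_sum_nat
  have hle : eLpNorm f (ENNReal.ofReal r) volume ≤
      ∑' k, eLpNorm (F k) (ENNReal.ofReal r) volume := by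
    refine Lp.eLpNorm_le_of_ae_tendsto (Eventually.of_forall fun n => ?_) hmeas hlim
    exact (eLpNorm_sum_le (fun k _ => (hF k).1.1) (by simpa using hr)).trans
      (ENNReal.sum_le_tsum _)
  refine ⟨⟨⟨aestronglyMeasurable_of_tendsto_ae _ hmeas hlim, hle.trans_lt he.lt_top⟩,
    fun g => ?_⟩, hle⟩
  have hint : ∀ k, Integrable fun x => g x • F k x := fun k =>
    (isKernel_schwartzMap g).integrable_smul hr (hF k).1
  have hsumm : Summable fun k => ∫ x, ‖g x • F k x‖ := by
    -- The supremum bounds `N k` are summable and `g` is integrable, which justifies integrating the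
    -- series term by term.
    have hb : ∑' k, ∫⁻ x, ‖g x • F k x‖ₑ ≠ ∞ := by
      refine ne_top_of_le_ne_top (ENNReal.mul_ne_top (isKernel_schwartzMap g).lintegral_ne_top hN)
        ?_
      rw [← ENNReal.tsum_mul_left]
      refine ENNReal.tsum_le_tsum fun k => ?_
      rw [← lintegral_mul_const _ g.continuous.enorm.measurable]
      refine lintegral_mono fun x => ?_
      rw [enorm_smul]
      gcongr
      exact hFN k x
    refine (ENNReal.summable_toReal hb).congr fun k => ?_
    rw [integral_norm_eq_lintegral_enorm (hint k).1]
  have h1 := hasSum_integral_of_summable_integral_norm hint hsumm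
  have h2 : ∀ x, ∑' k, g x • F k x = g x • f x := fun x => ((hs x).const_smul (g x)).tsum_eq
  simp only [h2, ← fun k => (hF k).2 g] at h1
  -- The same series sums to `u g`, because its partial sums are frequency cutoffs of `u`, and to
  -- the integral of `g • f`.
  exact (hasSum_piece hφ u g h1.summable).unique h1

theorem le_mul_of_forall_pos_le_mul_add {X c b : ℝ≥0∞} (hc : c ≠ ∞)
    (h : ∀ ε : ℝ≥0, 0 < ε → X ≤ c * (b + ε)) : X ≤ c * b := by
  have lim : Tendsto (fun ε : ℝ≥0 => c * (b + ε)) (𝓝[>] 0) (𝓝 (c * (b + (0 : ℝ≥0)))) := by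
    refine ENNReal.Tendsto.const_mul (Tendsto.const_add _ ?_) (Or.inr hc)
    exact (ENNReal.continuous_coe.tendsto 0).mono_left nhdsWithin_le_nhds
  rw [ENNReal.coe_zero, add_zero] at lim
  exact ge_of_tendsto lim (by filter_upwards [self_mem_nhdsWithin] with ε hε using h ε hε)

/-- Embedding of `B^{1/r}_{r,1}` into a space with a countably subadditive norm, controlled by
means of a size condition `P N F`, from a bound for single Littlewood-Paley pieces. -/
theorem embeds_besovENorm_of_piece [CompleteSpace E] (hφ : IsGenerator φ) (hr : 1 ≤ r)
    {NZ : (ℝ → E) → ℝ≥0∞} {P : ℝ≥0∞ → (ℝ → E) → Prop} {c : ℝ≥0∞} (hc : c ≠ ∞)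
    (hsup : ∀ N F, P N F → ∀ x, ‖F x‖ₑ ≤ N)
    (hsum : ∀ (N : ℕ → ℝ≥0∞) (F : ℕ → ℝ → E) (f : ℝ → E), (∀ k, P (N k) (F k)) →
      ∑' k, N k ≠ ∞ → (∀ x, HasSum (fun k => F k x) (f x)) → NZ f ≤ ∑' k, N k)
    (hP : ∀ (k : ℕ) (f : ℝ → E), MemLp f (ENNReal.ofReal r) →
      P (c * (weight r k * eLpNorm f (ENNReal.ofReal r) volume)) (conv (kernel φ (k + 1)) f)) :
    Embeds (besovENorm φ (1 / r) (ENNReal.ofReal r) 1) (interLpENorm (ENNReal.ofReal r) NZ) := by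
  have hr0 : 0 < r := by linarith
  set I := ∫⁻ x, ‖φ x‖ₑ with hI
  have hItop : I ≠ ∞ := (isKernel_schwartzMap φ).lintegral_ne_top
  have hCtop : c + I ≠ ∞ := ENNReal.add_ne_top.2 ⟨hc, hItop⟩
  refine ⟨(c + I).toNNReal, fun u hu => ?_⟩
  rw [ENNReal.coe_toNNReal hCtop]
  have hb : besovENorm φ (1 / r) (ENNReal.ofReal r) 1 u =
      ∑' k, weight r k * lpENorm (ENNReal.ofReal r) (piece φ k u) := by
    simp [besovENorm, seqENorm, weight]
  rw [hb] at hu ⊢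
  refine le_mul_of_forall_pos_le_mul_add hCtop fun ε hε => ?_
  -- Near-optimal representatives suffice: the error allowed for the `k`-th piece is `δ k` divided
  -- by its weight, so the weighted errors add up to less than `ε`.
  obtain ⟨δ, hδ, hδε⟩ := ENNReal.exists_pos_sum_of_countable (ε := ε) (by simpa using hε.ne') ℕ
  have hWtop : ∀ k, weight r k ≠ ∞ := fun k => ENNReal.ofReal_ne_top
  have hW0 : ∀ k, weight r k ≠ 0 := fun k => (zero_lt_one.trans_le (one_le_weight hr0 k)).ne'
  have hex : ∀ k, ∃ g : ℝ → E, Represents (ENNReal.ofReal r) g (piece φ k u) ∧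
      eLpNorm g (ENNReal.ofReal r) volume <
        lpENorm (ENNReal.ofReal r) (piece φ k u) + δ k / weight r k := by
    intro k
    have hk := ENNReal.ne_top_of_tsum_ne_top hu.ne k
    have hlp : lpENorm (ENNReal.ofReal r) (piece φ k u) ≠ ∞ := by
      intro h
      rw [h, ENNReal.mul_top (hW0 k)] at hk
      exact hk rfl
    have hlt : lpENorm (ENNReal.ofReal r) (piece φ k u) <
        lpENorm (ENNReal.ofReal r) (piece φ k u) + δ k / weight r k :=
      ENNReal.lt_add_right hlp (ENNReal.div_ne_zero.2 ⟨by simpa using (hδ k).ne', hWtop k⟩)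
    nth_rw 1 [lpENorm] at hlt
    simpa only [iInf_lt_iff, exists_prop] using hlt
  choose g hg hgn using hex
  set b : ℕ → ℝ≥0∞ := fun k => weight r k * eLpNorm (g k) (ENNReal.ofReal r) volume with hbdef
  have hbsum : ∑' k, b k ≤
      ∑' k, weight r k * lpENorm (ENNReal.ofReal r) (piece φ k u) + ε := by
    calc ∑' k, b k ≤ ∑' k, (weight r k * lpENorm (ENNReal.ofReal r) (piece φ k u) + δ k) := by
          refine ENNReal.tsum_le_tsum fun k => ?_
          refine (mul_le_mul_right (hgn k).le _).trans ?_
          rw [mul_add]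
          gcongr
          exact ENNReal.mul_div_le
      _ ≤ _ := by
          rw [ENNReal.tsum_add]
          gcongr
  have hbtop : ∑' k, b k ≠ ∞ :=
    ne_top_of_le_ne_top (ENNReal.add_ne_top.2 ⟨hu.ne, ENNReal.coe_ne_top⟩) hbsum
  -- The smooth replacements of the `g k`; they represent the same pieces by `lowPass_piece`.
  let F : ℕ → ℝ → E := fun k => conv (kernel φ (k + 1)) (g k)
  have hFrep : ∀ k, Represents (ENNReal.ofReal r) (F k) (piece φ k u) := by
    intro k
    have := (hg k).lowPass φ hr (k + 1)
    rwa [lowPass_piece hφ] at this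
  have hFP : ∀ k, P (c * b k) (F k) := fun k => hP k (g k) (hg k).1
  have hN : ∑' k, c * b k ≠ ∞ := by
    rw [ENNReal.tsum_mul_left]
    exact ENNReal.mul_ne_top hc hbtop
  have hs : ∀ x, HasSum (fun k => F k x) (∑' k, F k x) := fun x =>
    (summable_of_tsum_enorm_ne_top (ne_top_of_le_ne_top hN
      (ENNReal.tsum_le_tsum fun k => hsup _ _ (hFP k) x))).hasSum
  have heb : ∑' k, eLpNorm (F k) (ENNReal.ofReal r) volume ≤ I * ∑' k, b k := by
    rw [← ENNReal.tsum_mul_left]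
    refine ENNReal.tsum_le_tsum fun k => ?_
    refine (eLpNorm_conv_le (isKernel_kernel φ (k + 1)).continuous hr (hg k).1.1).trans ?_
    rw [lintegral_enorm_kernel]
    gcongr
    exact le_mul_of_one_le_left zero_le (one_le_weight hr0 k)
  obtain ⟨hrep, hnorm⟩ := represents_of_hasSum hφ hr hFrep (fun k => hsup _ _ (hFP k)) hN hs
    (ne_top_of_le_ne_top (ENNReal.mul_ne_top hItop hbtop) heb)
  calc interLpENorm (ENNReal.ofReal r) NZ u
      ≤ ∑' k, c * b k + I * ∑' k, b k :=
        (interLpENorm_le hrep).trans (add_le_add (hsum _ _ _ hFP hN hs) (hnorm.trans heb))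
    _ = (c + I) * ∑' k, b k := by rw [ENNReal.tsum_mul_left, add_mul]
    _ ≤ _ := by gcongr

/-! ### Bounds for a single frequency-localised piece -/

variable (φ)

theorem continuous_derivKernel (n : ℕ) :
    Continuous fun x => 2 ^ n * kernel (SchwartzMap.derivCLM ℂ ℂ φ) n x :=
  continuous_const.mul (isKernel_kernel _ n).continuous

theorem lintegral_enorm_derivKernel (n : ℕ) :
    ∫⁻ x, ‖2 ^ n * kernel (SchwartzMap.derivCLM ℂ ℂ φ) n x‖ₑ =
      2 ^ n * ∫⁻ x, ‖SchwartzMap.derivCLM ℂ ℂ φ x‖ₑ := by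
  have e : ‖(2 : ℂ) ^ n‖ₑ = 2 ^ n := by
    rw [enorm_pow]
    congr 1
    rw [← ofReal_norm]
    simp
  simp only [enorm_mul, e]
  rw [lintegral_const_mul' _ _ (by simp), lintegral_enorm_kernel]

/-- The grid starts at the natural scale `h = 2^{-k}`, for which `h^{-1/r}` is the Besov weight.
Differentiating the kernel at level `k + 1` costs `2^{k+1} = 2 / h`, whence the factor `2` in front
of the norm of the derivative of `φ`. -/
theorem hasGridExpansion_conv_kernel [CompleteSpace E] (hr : 1 < r)
    (hf : MemLp f (ENNReal.ofReal r)) (k : ℕ) :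
    HasGridExpansion r (2 * (1 - gridRatio r)⁻¹ * ((∫⁻ x, ‖φ x‖ₑ) +
      2 * ∫⁻ x, ‖SchwartzMap.derivCLM ℂ ℂ φ x‖ₑ) *
        (weight r k * eLpNorm f (ENNReal.ofReal r) volume)) (conv (kernel φ (k + 1)) f) := by
  have hr0 : 0 < r := by linarith
  set I := ∫⁻ x, ‖φ x‖ₑ with hI
  set I' := ∫⁻ x, ‖SchwartzMap.derivCLM ℂ ℂ φ x‖ₑ with hI'
  set e := eLpNorm f (ENNReal.ofReal r) volume with he
  have hItop : I ≠ ∞ := (isKernel_schwartzMap φ).lintegral_ne_top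
  have hI'top : I' ≠ ∞ := (isKernel_schwartzMap (SchwartzMap.derivCLM ℂ ℂ φ)).lintegral_ne_top
  have hK := isKernel_kernel φ (k + 1)
  have hK' := continuous_derivKernel φ (k + 1)
  have h2k : ENNReal.ofReal ((1 / 2) ^ k) * 2 ^ k = 1 := by
    rw [← ENNReal.ofReal_ofNat 2, ← ENNReal.ofReal_pow (by norm_num),
      ← ENNReal.ofReal_mul (by positivity), ← mul_pow]
    norm_num
  have key := hasGridExpansion_of_enorm_sub_le (F := conv (kernel φ (k + 1)) f) (r := r)
    (h := (1 / 2) ^ k) (W := weight r k) (A := (I + 2 * I') * e)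
    (measurable_lintegral_convolution hK'.enorm.measurable hf.1.enorm)
    (measurable_lintegral_convolution hK.continuous.enorm.measurable hf.1.enorm) hr
    (fun y x hyx => hK.enorm_conv_sub_le hK' (hasDerivAt_kernel φ (k + 1)) hr.le hf hyx)
    (enorm_conv_le _ f) (by positivity)
    (by rw [weight_rpow hr0, mul_comm, h2k])
    (ENNReal.mul_ne_top (ENNReal.add_ne_top.2 ⟨hItop, ENNReal.mul_ne_top (by simp) hI'top⟩)
      hf.2.ne)
    (by
      refine (lintegral_conv_rpow_le hK.continuous hr.le hf.1).trans ?_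
      rw [lintegral_enorm_kernel]
      gcongr
      exact le_self_add)
    (by
      refine (mul_le_mul_right (lintegral_conv_rpow_le hK' hr.le hf.1) _).trans ?_
      rw [← ENNReal.mul_rpow_of_nonneg _ _ hr0.le, lintegral_enorm_derivKernel]
      refine ENNReal.rpow_le_rpow ?_ hr0.le
      calc ENNReal.ofReal ((1 / 2) ^ k) * (2 ^ (k + 1) * I' * e)
          = ENNReal.ofReal ((1 / 2) ^ k) * 2 ^ k * (2 * I' * e) := by ring
        _ = 2 * I' * e := by rw [h2k, one_mul]
        _ ≤ (I + 2 * I') * e := by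
          gcongr
          exact le_add_self)
  convert key using 1
  ring

theorem embeds_besovENorm_rENorm [CompleteSpace E] {φ : 𝓢(ℝ, ℂ)} (hφ : IsGenerator φ)
    (hr : 1 < r) :
    Embeds (E := E) (besovENorm φ (1 / r) (ENNReal.ofReal r) 1)
      (interLpENorm (ENNReal.ofReal r) (rENorm r)) := by
  have hr0 : 0 < r := by linarith
  refine embeds_besovENorm_of_piece hφ hr.le (P := HasGridExpansion r) ?_
    (fun N F h => h.enorm_le hr0)
    (fun N F f hF hN hf => rENorm_le_of_hasGridExpansion hr0 hF hN hf)
    (fun k f hf => hasGridExpansion_conv_kernel φ hr hf k)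
  refine ENNReal.mul_ne_top (ENNReal.mul_ne_top (by simp) ?_) (ENNReal.add_ne_top.2
    ⟨(isKernel_schwartzMap φ).lintegral_ne_top, ENNReal.mul_ne_top (by simp)
      (isKernel_schwartzMap (SchwartzMap.derivCLM ℂ ℂ φ)).lintegral_ne_top⟩)
  simpa [tsub_eq_zero_iff_le] using gridRatio_lt_one hr

/-- For `r = 1` the increments over disjoint cells simply add up. -/
theorem variationSeminorm_one_le {F : ℝ → E} {G : ℝ → ℝ≥0∞}
    (hFG : ∀ y x, y ≤ x → ‖F x - F y‖ₑ ≤ ∫⁻ t in Set.Ioc y x, G t) :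
    variationSeminorm 1 F ≤ ∫⁻ t, G t := by
  refine iSup_le fun N => iSup₂_le fun t ht => ?_
  simp only [ENNReal.rpow_one, div_one]
  have hdisj : Pairwise (Function.onFun Disjoint fun i : Fin N =>
      Set.Ioc (t i.castSucc) (t i.succ)) := by
    rw [pairwise_disjoint_on]
    intro i j hij
    refine Set.disjoint_left.2 fun x hx hy => ?_
    have : t i.succ ≤ t j.castSucc := ht.monotone (by
      simp only [Fin.le_def, Fin.lt_def, Fin.val_succ, Fin.val_castSucc] at *
      omega)
    exact absurd (hx.2.trans this) (not_le.2 hy.1)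
  calc ∑ i : Fin N, ‖F (t i.succ) - F (t i.castSucc)‖ₑ
      ≤ ∑ i : Fin N, ∫⁻ x in Set.Ioc (t i.castSucc) (t i.succ), G x :=
        Finset.sum_le_sum fun i _ => hFG _ _ (ht.monotone (Fin.castSucc_lt_succ).le)
    _ = ∫⁻ x in ⋃ i : Fin N, Set.Ioc (t i.castSucc) (t i.succ), G x := by
        rw [lintegral_iUnion (fun i => measurableSet_Ioc) hdisj, tsum_fintype]
    _ ≤ _ := setLIntegral_le_lintegral _ _

/-- At `r = 1` the ratio of the dyadic expansion is one and its series diverges. Instead, the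
supremum of a piece is bounded through that of the kernel and its variation through the `L^1` norm
of the kernel's derivative; both cost `2^{k+1}`, twice the weight. -/
theorem embeds_besovENorm_vENorm_one [CompleteSpace E] {φ : 𝓢(ℝ, ℂ)} (hφ : IsGenerator φ) :
    Embeds (E := E) (besovENorm φ (1 / 1) (ENNReal.ofReal 1) 1)
      (interLpENorm (ENNReal.ofReal 1) (vENorm 1)) := by
  obtain ⟨B, hB, hφB⟩ := (isKernel_schwartzMap φ).bounded
  set I' := ∫⁻ x, ‖SchwartzMap.derivCLM ℂ ℂ φ x‖ₑ with hI'
  have hI'top : I' ≠ ∞ := (isKernel_schwartzMap (SchwartzMap.derivCLM ℂ ℂ φ)).lintegral_ne_top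
  have hweight : ∀ k, weight 1 k = 2 ^ k := fun k => by
    rw [← weight_rpow one_pos k, ENNReal.rpow_one]
  refine embeds_besovENorm_of_piece hφ le_rfl (c := 2 * B + 2 * I')
    -- The bound at every point is carried along because the `V^1` norm controls only the essential
    -- supremum, while the series of pieces must converge everywhere.
    (P := fun N F => (∀ x, ‖F x‖ₑ ≤ N) ∧ vENorm 1 F ≤ N)
    (ENNReal.add_ne_top.2 ⟨ENNReal.mul_ne_top (by simp) hB, ENNReal.mul_ne_top (by simp) hI'top⟩)
    (fun N F h => h.1)
    (fun N F f hF _ hf => (vENorm_le_of_hasSum le_rfl hf).trans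
      (ENNReal.tsum_le_tsum fun k => (hF k).2)) fun k f hf => ?_
  have hK := isKernel_kernel φ (k + 1)
  have hK' := continuous_derivKernel φ (k + 1)
  set e := eLpNorm f (ENNReal.ofReal 1) volume with he
  have he' : e = ∫⁻ x, ‖f x‖ₑ := by
    have := eLpNorm_ofReal_rpow one_pos f
    simpa only [ENNReal.rpow_one] using this
  have hsup : ∀ x, ‖conv (kernel φ (k + 1)) f x‖ₑ ≤ 2 * B * (weight 1 k * e) := by
    intro x
    refine (enorm_conv_le _ f x).trans ?_
    calc ∫⁻ y, ‖kernel φ (k + 1) (x - y)‖ₑ * ‖f y‖ₑ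
        ≤ ∫⁻ y, 2 ^ (k + 1) * B * ‖f y‖ₑ := by
          refine lintegral_mono fun y => ?_
          rw [enorm_kernel]
          gcongr
          exact hφB _
      _ = 2 * B * (weight 1 k * e) := by
          rw [lintegral_const_mul' _ _ (ENNReal.mul_ne_top (by simp) hB), ← he', hweight]
          ring
  have hvar : variationSeminorm 1 (conv (kernel φ (k + 1)) f) ≤ 2 * I' * (weight 1 k * e) := by
    refine (variationSeminorm_one_le fun y x hyx =>
      hK.enorm_conv_sub_le hK' (hasDerivAt_kernel φ (k + 1)) le_rfl hf hyx).trans ?_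
    have := lintegral_conv_rpow_le hK' le_rfl hf.1
    simp only [ENNReal.rpow_one] at this
    refine this.trans_eq ?_
    rw [lintegral_enorm_derivKernel, hweight]
    ring
  refine ⟨fun x => (hsup x).trans ?_, ?_⟩
  · gcongr
    exact le_self_add
  · rw [add_mul]
    refine add_le_add ?_ hvar
    rw [eLpNorm_exponent_top]
    exact essSup_le_of_ae_le _ (Eventually.of_forall hsup)

end Kernel

end BesovVariation

end

theorem lemma3p3 {E : Type*} [NormedAddCommGroup E] [NormedSpace ℂ E] [CompleteSpace E]
    (φ : 𝓢(ℝ, ℂ)) (hφ : BesovVariation.IsGenerator φ) :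
    (∀ r : ℝ, 1 < r →
      BesovVariation.Embeds (E := E)
        (BesovVariation.besovENorm φ (1 / r) (ENNReal.ofReal r) 1)
        (BesovVariation.interLpENorm (ENNReal.ofReal r) (BesovVariation.rENorm r)) ∧
      BesovVariation.Embeds (E := E)
        (BesovVariation.interLpENorm (ENNReal.ofReal r) (BesovVariation.rENorm r))
        (BesovVariation.interLpENorm (ENNReal.ofReal r) (BesovVariation.vENorm r)) ∧
      (∃ C : ℝ≥0, ∀ f : ℝ → E, MemLp f (ENNReal.ofReal r) volume →
        BesovVariation.rENorm r f < ∞ →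
          BesovVariation.vENorm r f + eLpNorm f (ENNReal.ofReal r) volume ≤
            C * (BesovVariation.rENorm r f + eLpNorm f (ENNReal.ofReal r) volume)) ∧
      BesovVariation.Embeds (E := E)
        (BesovVariation.interLpENorm (ENNReal.ofReal r) (BesovVariation.vENorm r))
        (BesovVariation.besovENorm φ (1 / r) (ENNReal.ofReal r) ∞)) ∧
    BesovVariation.Embeds (E := E)
      (BesovVariation.besovENorm φ 1 1 1)
      (BesovVariation.interLpENorm 1 (BesovVariation.vENorm 1)) ∧
    BesovVariation.Embeds (E := E)
      (BesovVariation.interLpENorm 1 (BesovVariation.vENorm 1))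
      (BesovVariation.besovENorm φ 1 1 ∞) := by
  refine ⟨fun r hr => ⟨BesovVariation.embeds_besovENorm_rENorm hφ hr,
    BesovVariation.embeds_rENorm_vENorm hr.le _,
    ⟨3, fun f _ _ => BesovVariation.vENorm_add_eLpNorm_le hr.le _ f⟩,
    BesovVariation.embeds_vENorm_besovENorm hφ hr.le⟩, ?_, ?_⟩
  · simpa using BesovVariation.embeds_besovENorm_vENorm_one (E := E) hφ
  · simpa using BesovVariation.embeds_vENorm_besovENorm (E := E) hφ le_rfl
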